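/- Let $G$ be a finite simple graph that contains no triangle $K_3$ and no induced subgraph isomorphic to a subdivision of $K_4$, where a subdivision of a graph is obtained by replacing its edges with internally disjoint paths of arbitrary length (at least one). Then $\chi(G)\leq 4$. -/

import Mathlib

namespace SimpleGraph

/-- The data exhibiting `H` as a subdivision of `G`: `H` arises from `G` by replacing each edge
`uv` with a path of length at least one from `branch u` to `branch v` (a path between two distinct
vertices has positive length), where the paths meet only in branch vertices. -/
structure Subdivision {α β : Type*} (G : SimpleGraph α) (H : SimpleGraph β) where
  /-- The vertices of `H` that correspond to the vertices of `G`. -/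
  branch : α → β
  branch_injective : Function.Injective branch
  /-- The path of `H` that replaces an edge of `G`. -/
  path : ∀ {u v : α}, G.Adj u v → H.Walk (branch u) (branch v)
  path_isPath : ∀ {u v : α} (h : G.Adj u v), (path h).IsPath
  /-- There is one path for each undirected edge. -/
  path_symm : ∀ {u v : α} (h : G.Adj u v), path h.symm = (path h).reverse
  /-- A path contains no branch vertices but its two ends. -/
  branch_mem_path : ∀ {u v : α} (h : G.Adj u v) (x : α),
    branch x ∈ (path h).support → x = u ∨ x = v
  /-- Paths that replace distinct edges have no common interior vertex. -/
  path_disjoint : ∀ {u v u' v' : α} (h : G.Adj u v) (h' : G.Adj u' v'), s(u, v) ≠ s(u', v') →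
    ∀ w : β, w ∈ (path h).support → w ∈ (path h').support → w ∈ Set.range branch
  /-- `H` has no vertices besides the branch vertices and those of the paths. -/
  vertex_cover : ∀ w : β, w ∈ Set.range branch ∨
    ∃ (u v : α) (h : G.Adj u v), w ∈ (path h).support
  /-- `H` has no edges besides those of the paths. -/
  edge_cover : ∀ e ∈ H.edgeSet, ∃ (u v : α) (h : G.Adj u v), e ∈ (path h).edges

/-- `H` is (isomorphic to) a subdivision of `G`. -/
def IsSubdivision {α β : Type*} (G : SimpleGraph α) (H : SimpleGraph β) : Prop :=
  Nonempty (Subdivision G H)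

/-- No induced subgraph of `G` is a subdivision of the complete graph on four vertices. -/
def ISK4Free {V : Type*} (G : SimpleGraph V) : Prop :=
  ∀ S : Set V, ¬ IsSubdivision (⊤ : SimpleGraph (Fin 4)) (G.induce S)

end SimpleGraph

/-! It suffices to treat a connected graph. Sort its vertices into layers by their distance from a
fixed vertex. Edges join vertices of the same or of consecutive layers, so if every layer induces a
bipartite graph, the parity of the layer together with a 2-colouring of each layer is a proper
4-colouring.

The source of forbidden subgraphs is this: if a connected set `T` sees exactly three vertices of a
hole, each through exactly one vertex of `T`, then there is an induced subdivision of K4. Indeed, in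
a triangle-free graph three vertices of a connected set are joined by an induced subdivided claw
(`exists_claw_subset`), and hole and claw form the subdivision (`not_ISK4Free_of_hole`). Connected
sets come for free from the layers above a given one.

Suppose a layer is not bipartite. It then contains a chordless odd cycle, of length at least five.
If a vertex `x` of the layer above had two neighbours on it, parity would give an arc of odd length
at least three with only its ends adjacent to `x`. `not_ISK4Free_of_sequence` excludes such arcs, by
induction on their length. Hence every vertex above has at most one neighbour on the cycle, and the
parents of three consecutive vertices together with the higher layers are a set `T` as described.

The induction for arcs rests on `not_ISK4Free_of_legs`, where two configurations of hole and
connected set are played against each other, according to how three vertices of a layer are joined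
from above (`exists_confluence`). -/

namespace SimpleGraph

/-! ### Induced paths, as vertex sets. -/

variable {V : Type*} {G : SimpleGraph V}

/-- `G.IsIndPath s u v`: the set `s` induces in `G` a path with ends `u` and `v`. -/
inductive IsIndPath (G : SimpleGraph V) : Set V → V → V → Prop
  | single (v : V) : IsIndPath G {v} v v
  | cons {a b v : V} {s : Set V} : G.Adj a b → IsIndPath G s b v → a ∉ s →
      (∀ x ∈ s, G.Adj a x → x = b) → IsIndPath G (insert a s) a v

namespace IsIndPath

theorem left_mem {s : Set V} {u v : V} (h : G.IsIndPath s u v) : u ∈ s := by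
  cases h <;> simp

theorem right_mem {s : Set V} {u v : V} (h : G.IsIndPath s u v) : v ∈ s := by
  induction h with
  | single => simp
  | cons _ _ _ _ ih => exact Or.inr ih

/-- Two induced paths that share one end and are otherwise anticomplete form an induced path. -/
theorem append {s t : Set V} {u m v : V} (hs : G.IsIndPath s u m) (ht : G.IsIndPath t m v)
    (hd : ∀ x ∈ s, x ∈ t → x = m)
    (hadj : ∀ x ∈ s, ∀ y ∈ t, G.Adj x y → x = m ∨ y = m) : G.IsIndPath (s ∪ t) u v := by
  induction hs with
  | single m =>
    rwa [Set.union_eq_self_of_subset_left (by simpa using ht.left_mem)]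
  | @cons a b m s hab hs ha hN ih =>
    rw [Set.insert_union]
    have ham : a ≠ m := fun h => ha (h ▸ hs.right_mem)
    refine .cons hab (ih ht (fun x hx => hd x (Or.inr hx)) fun x hx => hadj x (Or.inr hx)) ?_ ?_
    · rintro (h | h)
      · exact ha h
      · exact ham (hd a (Or.inl rfl) h)
    · rintro x (h | h) hx
      · exact hN x h hx
      · rcases hadj a (Or.inl rfl) x h hx with h' | h'
        · exact absurd h' ham
        · subst h'
          exact hN x hs.right_mem hx

theorem pair {a b : V} (h : G.Adj a b) : G.IsIndPath {a, b} a b :=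
  .cons h (.single b) (by simpa using h.ne) (by simp)

/-- Two disjoint induced paths joined by exactly one edge between their ends. -/
theorem join {s t : Set V} {u m n v : V} (hs : G.IsIndPath s u m) (ht : G.IsIndPath t n v)
    (hmn : G.Adj m n) (hd : ∀ x ∈ s, x ∉ t)
    (hadj : ∀ x ∈ s, ∀ y ∈ t, G.Adj x y → x = m ∧ y = n) : G.IsIndPath (s ∪ t) u v := by
  have h : G.IsIndPath (insert m t) m v :=
    .cons hmn ht (hd m hs.right_mem) fun x hx h => (hadj m hs.right_mem x hx h).2
  have h2 := hs.append h (by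
    rintro x hx (h | h)
    · exact h
    · exact absurd h (hd x hx)) (by
    rintro x hx y (rfl | h) hxy
    · exact Or.inr rfl
    · exact Or.inl (hadj x hx y h hxy).1)
  rwa [Set.union_insert, Set.insert_eq_of_mem (show m ∈ s ∪ t from Or.inl hs.right_mem)] at h2

theorem symm {s : Set V} {u v : V} (h : G.IsIndPath s u v) : G.IsIndPath s v u := by
  induction h with
  | single v => exact .single v
  | @cons a b v s hab hs ha hN ih =>
    rw [Set.insert_eq, Set.union_comm]
    refine ih.join (.single a) hab.symm (fun x hx h => ha (h ▸ hx)) ?_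
    rintro x hx y rfl h
    exact ⟨hN x hx h.symm, rfl⟩

/-- An induced path splits at each of its vertices. -/
theorem split {s : Set V} {u v m : V} (h : G.IsIndPath s u v) (hm : m ∈ s) :
    ∃ s₁ s₂, G.IsIndPath s₁ u m ∧ G.IsIndPath s₂ m v ∧ s = s₁ ∪ s₂ ∧
      (∀ x ∈ s₁, x ∈ s₂ → x = m) ∧ (∀ x ∈ s₁, ∀ y ∈ s₂, G.Adj x y → x = m ∨ y = m) := by
  induction h with
  | single v =>
    obtain rfl : m = v := hm
    exact ⟨{m}, {m}, .single m, .single m, by simp, by simp, by simp⟩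
  | @cons a b v s hab hs ha hN ih =>
    rcases hm with rfl | hm
    · refine ⟨{m}, _, .single m, .cons hab hs ha hN, by simp, by simp, by simp⟩
    · obtain ⟨s₁, s₂, h₁, h₂, rfl, hd, hadj⟩ := ih hm
      refine ⟨insert a s₁, s₂, .cons hab h₁ (fun h => ha (Or.inl h))
        (fun x hx => hN x (Or.inl hx)), h₂, by rw [Set.insert_union], ?_, ?_⟩
      · rintro x (rfl | hx) hx2
        · exact absurd (Or.inr hx2) ha
        · exact hd x hx hx2
      · rintro x (rfl | hx) y hy hxy
        · obtain rfl := hN y (Or.inr hy) hxy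
          exact Or.inr (hd y h₁.left_mem hy)
        · exact hadj x hx y hy hxy

theorem connected {s : Set V} {u v : V} (h : G.IsIndPath s u v) : (G.induce s).Connected := by
  induction h with
  | single v =>
    have : Nonempty ({v} : Set V) := ⟨⟨v, rfl⟩⟩
    refine ⟨fun x y => ?_⟩
    obtain rfl : x = y := Subtype.ext (x.2.trans y.2.symm)
    rfl
  | @cons a b v s hab hs ha hN ih =>
    have hp : (G.induce {a}).Preconnected := fun x y => by
      obtain rfl : x = y := Subtype.ext (x.2.trans y.2.symm)
      rfl
    exact connected_induce_union hp ih.preconnected rfl hs.left_mem hab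

theorem exists_walk {s : Set V} {u v : V} (h : G.IsIndPath s u v) :
    ∃ w : G.Walk u v, w.IsPath ∧ (∀ x, x ∈ w.support ↔ x ∈ s) ∧
      ∀ x ∈ s, ∀ y ∈ s, G.Adj x y → s(x, y) ∈ w.edges := by
  induction h with
  | single v => exact ⟨.nil, by simp, by simp, by simp⟩
  | @cons a b v s hab hs ha hN ih =>
    obtain ⟨w, hw, hsup, he⟩ := ih
    refine ⟨.cons hab w, by simp [hw, hsup, ha], by simp [hsup], ?_⟩
    rintro x (rfl | hx) y (rfl | hy) hxy
    · exact absurd hxy (G.loopless.irrefl _)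
    · obtain rfl := hN y hy hxy
      simp
    · obtain rfl := hN x hx hxy.symm
      simp [Sym2.eq_swap]
    · simp [he x hx y hy hxy]

theorem map {s : Set V} {t : Set s} {u v : s} (h : (G.induce s).IsIndPath t u v) :
    G.IsIndPath (Subtype.val '' t) u v := by
  induction h with
  | single v => simpa using .single (G := G) v.1
  | @cons a b v t hab ht ha hN ih =>
    rw [Set.image_insert_eq]
    refine .cons hab ih (by simpa using ha) ?_
    rintro _ ⟨x, hx, rfl⟩ h
    rw [hN x hx h]
    rfl

end IsIndPath

/-! ### Subdivisions of K4 assembled from six induced paths. -/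

/-- The edges of the complete graph on four vertices: three at the vertex `0`, and the others,
each indexed by the vertex other than `0` that is not on it. -/
def k4Edge (i j : Fin 4) : Fin 3 ⊕ Fin 3 :=
  ![![.inl 0, .inl 0, .inl 1, .inl 2], ![.inl 0, .inl 0, .inr 2, .inr 1],
    ![.inl 1, .inr 2, .inl 0, .inr 0], ![.inl 2, .inr 1, .inr 0, .inl 0]] i j

theorem k4Edge_comm : ∀ i j : Fin 4, k4Edge i j = k4Edge j i := by decide

theorem k4Edge_ne : ∀ i j k l : Fin 4, i ≠ j → k ≠ l → s(i, j) ≠ s(k, l) →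
    k4Edge i j ≠ k4Edge k l := by decide

theorem exists_k4Edge (e : Fin 3 ⊕ Fin 3) : ∃ i j : Fin 4, i ≠ j ∧ k4Edge i j = e := by
  revert e; decide

/-- The union of the six paths induces the subdivision once every edge between two of them already
lies in a single path. An edge between two branch vertices is harmless: both are ends of the path
that joins them, which is induced and so consists of that edge. -/
theorem not_ISK4Free_of_paths (b : Fin 4 → V) (hb : Function.Injective b)
    (P : Fin 3 ⊕ Fin 3 → Set V)
    (hP : ∀ i j, i ≠ j → G.IsIndPath (P (k4Edge i j)) (b i) (b j))
    (hbP : ∀ i j k, i ≠ j → b k ∈ P (k4Edge i j) → k = i ∨ k = j)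
    (hd : ∀ e f, e ≠ f → ∀ x ∈ P e, x ∈ P f → x ∈ Set.range b)
    (hadj : ∀ e f, e ≠ f → ∀ x ∈ P e, ∀ y ∈ P f, G.Adj x y →
      x ∈ P f ∨ y ∈ P e ∨ x ∈ Set.range b ∧ y ∈ Set.range b) : ¬ G.ISK4Free := by
  classical
  intro hfree
  let S : Set V := ⋃ e, P e
  have hS : ∀ e, ∀ x ∈ P e, x ∈ S := fun e x hx => Set.mem_iUnion.2 ⟨e, hx⟩
  have hbS : ∀ i, b i ∈ S := fun i => by
    obtain ⟨j, hj⟩ : ∃ j, i ≠ j := ⟨i + 1, by revert i; decide⟩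
    exact hS _ _ (hP i j hj).left_mem
  have key : ∀ i j, i ≠ j → ∃ w : (G.induce S).Walk ⟨b i, hbS i⟩ ⟨b j, hbS j⟩, w.IsPath ∧
      (∀ x, x ∈ w.support ↔ x.1 ∈ P (k4Edge i j)) ∧
      ∀ x y : S, x.1 ∈ P (k4Edge i j) → y.1 ∈ P (k4Edge i j) → G.Adj x y → s(x, y) ∈ w.edges := by
    intro i j hij
    obtain ⟨w, hw, hsup, he⟩ := (hP i j hij).exists_walk
    have hwS : ∀ x ∈ w.support, x ∈ S := fun x hx => hS _ x ((hsup x).1 hx)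
    have hmap := Walk.map_induce (s := S) w hwS
    refine ⟨w.induce S hwS, ?_, ?_, ?_⟩
    · rw [← hmap] at hw
      exact Walk.IsPath.of_map hw
    · intro x
      rw [Walk.support_induce]
      simp [List.mem_attachWith, hsup]
    · intro x y hx hy hxy
      have h := he x hx y hy hxy
      have hmap' : w.edges = _ := (congrArg Walk.edges hmap).symm.trans (Walk.edges_map _ _)
      rw [hmap'] at h
      obtain ⟨e, he1, he2⟩ := List.mem_map.1 h
      have : e = s(x, y) := by
        apply Sym2.map.injective (f := (Embedding.induce (G := G) S).toHom) Subtype.val_injective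
        rw [he2]; rfl
      rwa [this] at he1
  choose w hw hsup hedge using key
  -- The walks chosen for `(i, j)` and `(j, i)` are unrelated, so only the one with `i < j` is kept,
  -- and reversed for the other direction.
  let p : ∀ {i j : Fin 4}, (⊤ : SimpleGraph (Fin 4)).Adj i j →
      (G.induce S).Walk ⟨b i, hbS i⟩ ⟨b j, hbS j⟩ := fun {i j} h =>
    if i < j then w i j h.ne else (w j i h.ne.symm).reverse
  have psup : ∀ {i j : Fin 4} (h : (⊤ : SimpleGraph (Fin 4)).Adj i j) x,
      x ∈ (p h).support ↔ x.1 ∈ P (k4Edge i j) := by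
    intro i j h x
    simp only [p]
    split_ifs
    · rw [hsup]
    · rw [Walk.support_reverse, List.mem_reverse, hsup, k4Edge_comm]
  have pedge : ∀ {i j : Fin 4} (h : (⊤ : SimpleGraph (Fin 4)).Adj i j) (x y : S),
      x.1 ∈ P (k4Edge i j) → y.1 ∈ P (k4Edge i j) → G.Adj x y → s(x, y) ∈ (p h).edges := by
    intro i j h x y hx hy hxy
    simp only [p]
    split_ifs
    · exact hedge _ _ _ x y hx hy hxy
    · rw [Walk.edges_reverse, List.mem_reverse]
      rw [k4Edge_comm] at hx hy
      exact hedge _ _ _ x y hx hy hxy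
  refine hfree S ⟨⟨fun i => ⟨b i, hbS i⟩, fun i j h => hb (congrArg Subtype.val h), p, ?_, ?_, ?_,
    ?_, ?_, ?_⟩⟩
  · intro i j h
    simp only [p]
    split_ifs
    · exact hw _ _ _
    · exact (hw _ _ _).reverse
  · intro i j h
    have hne := h.ne
    rcases lt_or_gt_of_ne hne with h1 | h1
    · simp [p, h1, h1.not_gt]
    · simp [p, h1, h1.not_gt]
  · intro i j h k hk
    exact hbP i j k h.ne ((psup h _).1 hk)
  · intro i j k l h h' hne x hx hx'
    obtain ⟨m, hm⟩ := hd _ _ (k4Edge_ne i j k l h.ne h'.ne hne) x ((psup h x).1 hx)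
      ((psup h' x).1 hx')
    exact ⟨m, Subtype.ext hm⟩
  · rintro ⟨x, hx⟩
    obtain ⟨e, he⟩ := Set.mem_iUnion.1 hx
    obtain ⟨i, j, hij, rfl⟩ := exists_k4Edge e
    exact Or.inr ⟨i, j, hij, (psup (show (⊤ : SimpleGraph (Fin 4)).Adj i j from hij) _).2 he⟩
  · intro e
    induction e using Sym2.ind with
    | _ x y =>
      intro hxy
      have hxy' : G.Adj x.1 y.1 := hxy
      have fin : ∀ e, x.1 ∈ P e → y.1 ∈ P e → ∃ (i j : Fin 4)
          (h : (⊤ : SimpleGraph (Fin 4)).Adj i j), s(x, y) ∈ (p h).edges := by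
        intro e hx hy
        obtain ⟨i, j, hij, rfl⟩ := exists_k4Edge e
        exact ⟨i, j, hij, pedge (show (⊤ : SimpleGraph (Fin 4)).Adj i j from hij) x y hx hy hxy'⟩
      obtain ⟨e, he⟩ := Set.mem_iUnion.1 x.2
      obtain ⟨f, hf⟩ := Set.mem_iUnion.1 y.2
      by_cases hef : e = f
      · subst hef
        exact fin e he hf
      rcases hadj e f hef x he y hf hxy' with h | h | ⟨⟨i, hi⟩, ⟨j, hj⟩⟩
      · exact fin f h hf
      · exact fin e he h
      · have hij : i ≠ j := by
          rintro rfl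
          exact hxy'.ne (hi.symm.trans hj)
        have := hP i j hij
        exact fin (k4Edge i j) (hi ▸ this.left_mem) (hj ▸ this.right_mem)

/-! ### Shortest paths and induced claws in triangle-free graphs. -/

theorem not_adj_of_common_adj (htri : G.CliqueFree 3) {a b c : V} (hab : G.Adj a b)
    (hac : G.Adj a c) : ¬ G.Adj b c := fun hbc => by
  classical
  exact htri {a, b, c} (is3Clique_triple_iff.2 ⟨hab, hac, hbc⟩)

theorem Connected.exists_isIndPath (hG : G.Connected) (u v : V) :
    ∃ s, G.IsIndPath s u v ∧ ∀ x ∈ s, G.dist u x + G.dist x v = G.dist u v := by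
  induction hd : G.dist u v generalizing u with
  | zero =>
    obtain rfl := hG.dist_eq_zero_iff.1 hd
    exact ⟨{u}, .single u, by simp⟩
  | succ d ih =>
    obtain ⟨w, hw⟩ := hG.exists_walk_length_eq_dist u v
    cases w with
    | nil => simp at hd
    | @cons _ m _ huv w =>
      have hm : G.dist m v = d := by
        have h1 := G.dist_le w
        have h2 := hG.dist_triangle (u := u) (v := m) (w := v)
        rw [dist_eq_one_iff_adj.2 huv] at h2
        simp at hw
        omega
      obtain ⟨s, hs, hsd⟩ := ih m hm
      refine ⟨insert u s, .cons huv hs ?_ ?_, ?_⟩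
      · intro hus
        have := hsd u hus
        omega
      · intro x hx hux
        have h1 := hsd x hx
        have h2 := hG.dist_triangle (u := u) (v := x) (w := v)
        rw [dist_eq_one_iff_adj.2 hux] at h2
        exact (hG.dist_eq_zero_iff.1 (by omega : G.dist m x = 0)).symm
      · rintro x (rfl | hx)
        · simp [hd]
        · have h1 := hsd x hx
          have h2 := hG.dist_triangle (u := u) (v := x) (w := v)
          have h3 := hG.dist_triangle (u := u) (v := m) (w := x)
          rw [dist_eq_one_iff_adj.2 huv] at h3
          omega

theorem exists_isIndPath_subset {T : Set V} (hT : (G.induce T).Preconnected) {u v : V}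
    (hu : u ∈ T) (hv : v ∈ T) : ∃ s ⊆ T, G.IsIndPath s u v := by
  have : Nonempty T := ⟨⟨u, hu⟩⟩
  obtain ⟨s, hs, -⟩ := (Connected.mk hT).exists_isIndPath ⟨u, hu⟩ ⟨v, hv⟩
  exact ⟨_, by simp, hs.map⟩

/-- In a connected triangle-free graph, three vertices are joined by an induced subdivision of the
claw, some of whose legs may be trivial. -/
theorem Connected.exists_claw (hG : G.Connected) (htri : G.CliqueFree 3) (t : Fin 3 → V) :
    ∃ o, ∃ Q : Fin 3 → Set V, (∀ i, G.IsIndPath (Q i) o (t i)) ∧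
      ∀ i j, i ≠ j → ∀ x ∈ Q i, ∀ y ∈ Q j, (x = y → x = o) ∧ (G.Adj x y → x = o ∨ y = o) := by
  -- The centre minimises the total distance to the three ends, and the legs are shortest paths from
  -- it.
  obtain ⟨o, ho⟩ : ∃ o, ∀ o', ∑ i, G.dist o (t i) ≤ ∑ i, G.dist o' (t i) := by
    have := hG.nonempty
    exact ⟨Function.argmin fun o => ∑ i, G.dist o (t i),
      fun o' => Function.argmin_le (fun o => ∑ i, G.dist o (t i)) o'⟩
  choose Q hQ hQd using fun i => hG.exists_isIndPath o (t i)
  have htr : ∀ a b c, G.dist a c ≤ G.dist a b + G.dist b c :=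
    fun a b c => hG.dist_triangle
  have hmin : ∀ i j, i ≠ j → ∀ o', ∃ k, G.dist o (t i) + G.dist o (t j) + G.dist o (t k) ≤
      G.dist o' (t i) + G.dist o' (t j) + G.dist o' (t k) := by
    intro i j hij o'
    have h := ho o'
    simp only [Fin.sum_univ_three] at h
    obtain ⟨k, hk⟩ : ∃ k : Fin 3, k ≠ i ∧ k ≠ j := by revert i j; decide
    refine ⟨k, ?_⟩
    fin_cases i <;> fin_cases j <;> fin_cases k <;> simp_all <;> omega
  -- Moving the centre to `x` brings it nearer to `t i` by `dist o x` and away from `t k` by at most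
  -- as much, so by minimality it gets no nearer to `t j`. A detour through `y` then forces `dist o
  -- y ≤ 1`. Used in both directions, this makes `o`, `x`, `y` a triangle.
  have hadj1 : ∀ i j, i ≠ j → ∀ x ∈ Q i, ∀ y ∈ Q j, G.Adj x y → x ≠ o → G.dist o y ≤ 1 := by
    intro i j hij x hx y hy hxy hxo
    obtain ⟨k, hk⟩ := hmin i j hij x
    have h1 := hQd i x hx
    have h2 := hQd j y hy
    have h3 := htr x y (t j)
    have h4 := htr x o (t k)
    rw [dist_eq_one_iff_adj.2 hxy] at h3
    have h5 := hG.pos_dist_of_ne hxo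
    rw [G.dist_comm (u := x) (v := o)] at h4 h5
    omega
  refine ⟨o, Q, hQ, fun i j hij x hx y hy => ⟨?_, ?_⟩⟩
  · rintro rfl
    by_contra hxo
    obtain ⟨k, hk⟩ := hmin i j hij x
    have h1 := hQd i x hx
    have h2 := hQd j x hy
    have h4 := htr x o (t k)
    have h5 := hG.pos_dist_of_ne hxo
    rw [G.dist_comm (u := x) (v := o)] at h4 h5
    omega
  · intro hxy
    by_contra! h
    have hy1 := hadj1 i j hij x hx y hy hxy h.1
    have hx1 := hadj1 j i hij.symm y hy x hx hxy.symm h.2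
    have hy2 := hG.pos_dist_of_ne h.2.symm
    have hx2 := hG.pos_dist_of_ne h.1.symm
    exact not_adj_of_common_adj htri (dist_eq_one_iff_adj.1 (by omega : G.dist o x = 1))
      (dist_eq_one_iff_adj.1 (by omega : G.dist o y = 1)) hxy

theorem exists_claw_subset (htri : G.CliqueFree 3) {T : Set V} (hT : (G.induce T).Preconnected)
    (t : Fin 3 → V) (ht : ∀ i, t i ∈ T) :
    ∃ o ∈ T, ∃ Q : Fin 3 → Set V, (∀ i, G.IsIndPath (Q i) o (t i) ∧ Q i ⊆ T) ∧
      ∀ i j, i ≠ j → ∀ x ∈ Q i, ∀ y ∈ Q j, (x = y → x = o) ∧ (G.Adj x y → x = o ∨ y = o) := by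
  have : Nonempty T := ⟨⟨t 0, ht 0⟩⟩
  have htri' : (G.induce T).CliqueFree 3 := htri.comap ⟨Copy.induce G T⟩
  obtain ⟨o, Q, hQ, hd⟩ := (Connected.mk hT).exists_claw htri' fun i => ⟨t i, ht i⟩
  refine ⟨o, o.2, fun i => Subtype.val '' Q i, fun i => ⟨(hQ i).map, by simp⟩, ?_⟩
  rintro i j hij _ ⟨x, hx, rfl⟩ _ ⟨y, hy, rfl⟩
  obtain ⟨h1, h2⟩ := hd i j hij x hx y hy
  exact ⟨fun h => congrArg Subtype.val (h1 (Subtype.ext h)),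
    fun h => (h2 h).imp (congrArg Subtype.val) (congrArg Subtype.val)⟩

/-! ### Holes attached to a connected set at three vertices. -/

/-- A hole, composed of induced paths `R i`, together with a connected set in which the three ends
of these paths have exactly one neighbour each. -/
theorem not_ISK4Free_of_rim (htri : G.CliqueFree 3) (h : Fin 3 → V) (hh : Function.Injective h)
    (R : Fin 3 → Set V) (hR : ∀ i, G.IsIndPath (R i) (h (i + 1)) (h (i + 2)))
    (hRd : ∀ i j, i ≠ j → ∀ x ∈ R i, x ∈ R j → x ∈ Set.range h)
    (hhR : ∀ i, h i ∉ R i)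
    (hRadj : ∀ i j, i ≠ j → ∀ x ∈ R i, ∀ y ∈ R j, G.Adj x y →
      x ∈ R j ∨ y ∈ R i ∨ x ∈ Set.range h ∧ y ∈ Set.range h)
    {T : Set V} (hT : (G.induce T).Preconnected) (t : Fin 3 → V) (ht : ∀ i, t i ∈ T)
    (hth : ∀ i, G.Adj (h i) (t i)) (hRT : ∀ i, ∀ x ∈ R i, x ∉ T)
    (hRTadj : ∀ i, ∀ x ∈ R i, ∀ y ∈ T, G.Adj x y → ∃ j, x = h j ∧ y = t j) : ¬ G.ISK4Free := by
  obtain ⟨o, ho, Q, hQ, hQQ⟩ := exists_claw_subset htri hT t ht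
  have hmemR : ∀ i j, i ≠ j → h i ∈ R j := by
    intro i j hij
    have h1 := (hR j).left_mem
    have h2 := (hR j).right_mem
    have : i = j + 1 ∨ i = j + 2 := by clear h1 h2; revert i j; decide
    rcases this with rfl | rfl <;> assumption
  have hhT : ∀ i, h i ∉ T := fun i => hRT (i + 1) _ (hmemR _ _ (by revert i; decide))
  have hhTadj : ∀ i, ∀ y ∈ T, G.Adj (h i) y → y = t i := by
    intro i y hy hadj
    have hi : i ≠ i + 1 := by clear hadj; revert i; decide
    obtain ⟨j, hj, rfl⟩ := hRTadj (i + 1) (h i) (hmemR _ _ hi) y hy hadj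
    rw [hh hj]
  have hL : ∀ i, G.IsIndPath (insert (h i) (Q i)) (h i) o := fun i =>
    .cons (hth i) (hQ i).1.symm (fun hm => hhT i ((hQ i).2 hm))
      fun x hx hadj => hhTadj i x ((hQ i).2 hx) hadj
  have hhQ : ∀ i j, h i ∉ Q j := fun i j hm => hhT i ((hQ j).2 hm)
  have hoR : ∀ i, o ∉ R i := fun i hm => hRT i o hm ho
  have hoh : ∀ i, o ≠ h i := fun i e => hhT i (e ▸ ho)
  have hrange : ∀ x, x ∈ Set.range (Fin.cons o h : Fin 4 → V) ↔ x = o ∨ ∃ i, x = h i := by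
    intro x
    simp [Fin.range_cons, eq_comm]
  -- The branch vertices are the centre of the claw and the three corners `h i`. Each leg is
  -- prolonged by its corner, so a trivial leg becomes an edge.
  refine not_ISK4Free_of_paths (Fin.cons o h)
    (Fin.cons_injective_iff.2 ⟨by rintro ⟨i, hi⟩; exact hoh i hi.symm, hh⟩)
    (Sum.elim (fun i => insert (h i) (Q i)) R) ?_ ?_ ?_ ?_
  · have hL0 := hL 0
    have hL1 := hL 1
    have hL2 := hL 2
    have hR0 : G.IsIndPath (R 0) (h 1) (h 2) := hR 0
    have hR1 : G.IsIndPath (R 1) (h 2) (h 0) := hR 1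
    have hR2 : G.IsIndPath (R 2) (h 0) (h 1) := hR 2
    intro i j hij
    fin_cases i <;> fin_cases j <;> first
      | exact absurd rfl hij
      | exact hL0
      | exact hL1
      | exact hL2
      | exact hR0
      | exact hR1
      | exact hR2
      | exact hL0.symm
      | exact hL1.symm
      | exact hL2.symm
      | exact hR0.symm
      | exact hR1.symm
      | exact hR2.symm
  · have hhL : ∀ i j, h i ∈ insert (h j) (Q j) → i = j := by
      rintro i j (e | e)
      · exact hh e
      · exact absurd e (hhQ i j)
    intro i j k hij
    refine Fin.cases ?_ (fun k => ?_) k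
    · intro hk
      fin_cases i <;> fin_cases j <;> first
        | exact absurd rfl hij
        | exact Or.inl rfl
        | exact Or.inr rfl
        | exact absurd hk (hoR _)
    · intro hk
      fin_cases i <;> fin_cases j <;> first
        | exact absurd rfl hij
        | (have e := hhL k 0 hk; subst e; first | exact Or.inl rfl | exact Or.inr rfl)
        | (have e := hhL k 1 hk; subst e; first | exact Or.inl rfl | exact Or.inr rfl)
        | (have e := hhL k 2 hk; subst e; first | exact Or.inl rfl | exact Or.inr rfl)
        | (fin_cases k <;> first
            | exact Or.inl rfl
            | exact Or.inr rfl
            | exact absurd hk (hhR 0)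
            | exact absurd hk (hhR 1)
            | exact absurd hk (hhR 2))
  · rintro (i | i) (j | j) hne x hx hx'
    · rw [hrange]
      rcases hx with rfl | hx
      · exact Or.inr ⟨i, rfl⟩
      · rcases hx' with rfl | hx'
        · exact Or.inr ⟨j, rfl⟩
        · exact Or.inl ((hQQ i j (by simpa using hne) x hx x hx').1 rfl)
    · rw [hrange]
      rcases hx with rfl | hx
      · exact Or.inr ⟨i, rfl⟩
      · exact absurd ((hQ i).2 hx) (hRT j x hx')
    · rw [hrange]
      rcases hx' with rfl | hx'
      · exact Or.inr ⟨j, rfl⟩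
      · exact absurd ((hQ j).2 hx') (hRT i x hx)
    · rw [hrange]
      obtain ⟨k, rfl⟩ := hRd i j (by simpa using hne) x hx hx'
      exact Or.inr ⟨k, rfl⟩
  · have hLR : ∀ i j, ∀ x ∈ insert (h i) (Q i), ∀ y ∈ R j, G.Adj x y →
        y ∈ insert (h i) (Q i) ∨ x ∈ R j ∨
          (x = o ∨ ∃ k, x = h k) ∧ (y = o ∨ ∃ k, y = h k) := by
      rintro i j x (rfl | hx) y hy hxy
      · by_cases hij : i = j
        · subst hij
          have hi : i ≠ i + 1 := by clear hxy hy; revert i; decide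
          rcases hRadj _ _ hi.symm (h i) (hmemR _ _ hi) y hy hxy with h' | h' | ⟨-, k, rfl⟩
          · exact absurd h' (hhR i)
          · obtain ⟨k, rfl⟩ := hRd _ _ hi y hy h'
            exact Or.inr (Or.inr ⟨Or.inr ⟨i, rfl⟩, Or.inr ⟨k, rfl⟩⟩)
          · exact Or.inr (Or.inr ⟨Or.inr ⟨i, rfl⟩, Or.inr ⟨k, rfl⟩⟩)
        · exact Or.inr (Or.inl (hmemR _ _ hij))
      · obtain ⟨k, rfl, rfl⟩ := hRTadj j y hy x ((hQ i).2 hx) hxy.symm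
        by_cases hik : i = k
        · subst hik
          exact Or.inl (Or.inl rfl)
        · have := (hQQ i k hik _ hx _ (hQ k).1.right_mem).1 rfl
          exact Or.inr (Or.inr ⟨Or.inl this, Or.inr ⟨k, rfl⟩⟩)
    rintro (i | i) (j | j) hne x hx y hy hxy
    · have hij : i ≠ j := by simpa using hne
      simp only [hrange]
      rcases hx with rfl | hx
      · rcases hy with rfl | hy
        · exact Or.inr (Or.inr ⟨Or.inr ⟨i, rfl⟩, Or.inr ⟨j, rfl⟩⟩)
        · obtain rfl := hhTadj i y ((hQ j).2 hy) hxy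
          have := (hQQ i j hij _ (hQ i).1.right_mem _ hy).1 rfl
          exact Or.inr (Or.inl (Or.inr (hQ i).1.right_mem))
      · rcases hy with rfl | hy
        · obtain rfl := hhTadj j x ((hQ i).2 hx) hxy.symm
          exact Or.inl (Or.inr (hQ j).1.right_mem)
        · rcases (hQQ i j hij x hx y hy).2 hxy with rfl | rfl
          · exact Or.inl (Or.inr (hQ j).1.left_mem)
          · exact Or.inr (Or.inl (Or.inr (hQ i).1.left_mem))
    · simp only [hrange]
      rcases hLR i j x hx y hy hxy with h' | h' | h'
      exacts [Or.inr (Or.inl h'), Or.inl h', Or.inr (Or.inr h')]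
    · simp only [hrange]
      rcases hLR j i y hy x hx hxy.symm with h' | h' | h'
      exacts [Or.inl h', Or.inr (Or.inl h'), Or.inr (Or.inr h'.symm)]
    · have hr : ∀ z, z ∈ Set.range h → z ∈ Set.range (Fin.cons o h : Fin 4 → V) := by
        rintro _ ⟨k, rfl⟩
        exact ⟨k.succ, rfl⟩
      exact (hRadj i j (by simpa using hne) x hx y hy hxy).imp_right
        (Or.imp_right (And.imp (hr x) (hr y)))

theorem forall_ne_fin_three {P : Fin 3 → Fin 3 → Prop} (hP : ∀ i j, P i j → P j i)
    (h01 : P 0 1) (h02 : P 0 2) (h12 : P 1 2) (i j : Fin 3) (hij : i ≠ j) : P i j := by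
  fin_cases i <;> fin_cases j <;> first
    | exact absurd rfl hij
    | assumption
    | exact hP _ _ (by assumption)

/-- The hole is `a`, `s₁` from `u` to `b`, `m` from `b` to `c`, and `s₂` from `c` to `v`. Adding `a`
to the outer two pieces yields the three rim paths between the corners `a`, `b`, `c`. A chord from
`a` to `b` or `c` within `m` can be tolerated only as an edge between corners. -/
theorem not_ISK4Free_of_three_paths (htri : G.CliqueFree 3) {a b c u v : V} {s₁ m s₂ : Set V}
    (h₁ : G.IsIndPath s₁ u b) (hm : G.IsIndPath m b c) (h₂ : G.IsIndPath s₂ c v) (hbc : b ≠ c)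
    (hd₁ : ∀ x ∈ s₁, x ∈ m → x = b) (hd₂ : ∀ x ∈ m, x ∈ s₂ → x = c) (hd : ∀ x ∈ s₁, x ∉ s₂)
    (hadj₁ : ∀ x ∈ s₁, ∀ y ∈ m, G.Adj x y → x = b ∨ y = b)
    (hadj₂ : ∀ x ∈ m, ∀ y ∈ s₂, G.Adj x y → x = c ∨ y = c)
    (hadj : ∀ x ∈ s₁, ∀ y ∈ s₂, G.Adj x y → x = b ∧ y = c)
    (ha₁ : a ∉ s₁) (ham : a ∉ m) (ha₂ : a ∉ s₂) (hau : G.Adj a u) (hav : G.Adj a v)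
    (hN₁ : ∀ x ∈ s₁, G.Adj a x → x = u) (hNm : ∀ x ∈ m, G.Adj a x → x = b ∨ x = c)
    (hN₂ : ∀ x ∈ s₂, G.Adj a x → x = v)
    {T : Set V} (hT : (G.induce T).Preconnected) {ta tb tc : V} (hta : ta ∈ T) (htb : tb ∈ T)
    (htc : tc ∈ T) (haT : a ∉ T) (hT₁ : ∀ x ∈ s₁, x ∉ T) (hTm : ∀ x ∈ m, x ∉ T)
    (hT₂ : ∀ x ∈ s₂, x ∉ T) (hata : G.Adj a ta) (hbtb : G.Adj b tb) (hctc : G.Adj c tc)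
    (haN : ∀ y ∈ T, G.Adj a y → y = ta)
    (hTN : ∀ x, x ∈ s₁ ∨ x ∈ m ∨ x ∈ s₂ → ∀ y ∈ T, G.Adj x y → x = b ∧ y = tb ∨ x = c ∧ y = tc) :
    ¬ G.ISK4Free := by
  have hb₁ := h₁.right_mem
  have hbm := hm.left_mem
  have hcm := hm.right_mem
  have hc₂ := h₂.left_mem
  have hab : a ≠ b := fun h => ham (h ▸ hbm)
  have hac : a ≠ c := fun h => ham (h ▸ hcm)
  have hR : ∀ i, ∀ x ∈ (![m, insert a s₂, insert a s₁] : Fin 3 → Set V) i,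
      x = a ∨ x ∈ s₁ ∨ x ∈ m ∨ x ∈ s₂ := by
    intro i x hx
    fin_cases i
    · exact Or.inr (Or.inr (Or.inl hx))
    · exact hx.imp_right fun h => Or.inr (Or.inr h)
    · exact hx.imp_right Or.inl
  have hrange : ∀ x, x ∈ Set.range (![a, b, c] : Fin 3 → V) ↔ x = a ∨ x = b ∨ x = c := by
    intro x
    simp only [Set.mem_range, Fin.exists_fin_succ, Matrix.cons_val_zero, Matrix.cons_val_succ]
    simp [eq_comm]
  have hsym : ∀ x y, G.Adj x y → G.Adj y x := fun x y h => h.symm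
  refine not_ISK4Free_of_rim htri ![a, b, c] ?_ ![m, insert a s₂, insert a s₁] ?_ ?_ ?_ ?_
    hT ![ta, tb, tc] ?_ ?_ ?_ ?_
  · intro i j h
    by_contra hij
    revert h
    refine forall_ne_fin_three (P := fun i j => ¬ (![a, b, c] : Fin 3 → V) i = ![a, b, c] j)
      (fun i j h h' => h h'.symm) hab hac hbc i j hij
  · intro i
    fin_cases i
    · exact hm
    · exact (IsIndPath.cons hav h₂.symm ha₂ hN₂).symm
    · exact .cons hau h₁ ha₁ hN₁
  · simp only [hrange]
    refine forall_ne_fin_three (fun i j h x hx hy => h x hy hx) ?_ ?_ ?_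
    · rintro x hx (rfl | hy)
      exacts [Or.inl rfl, Or.inr (Or.inr (hd₂ x hx hy))]
    · rintro x hx (rfl | hy)
      exacts [Or.inl rfl, Or.inr (Or.inl (hd₁ x hy hx))]
    · rintro x (rfl | hx) (h | hy)
      exacts [Or.inl rfl, Or.inl rfl, Or.inl h, absurd hx (hd x hy)]
  · intro i
    fin_cases i
    · exact ham
    · rintro (h | h)
      exacts [hab h.symm, hd b hb₁ h]
    · rintro (h | h)
      exacts [hac h.symm, hd c h hc₂]
  · simp only [hrange]
    refine forall_ne_fin_three (fun i j h x hx y hy hxy => ?_) ?_ ?_ ?_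
    · have := h y hy x hx hxy.symm
      tauto
    · rintro x hx y (rfl | hy) hxy
      · exact Or.inr (Or.inr ⟨Or.inr (hNm x hx hxy.symm), Or.inl rfl⟩)
      · rcases hadj₂ x hx y hy hxy with rfl | rfl
        exacts [Or.inl (Or.inr hc₂), Or.inr (Or.inl hcm)]
    · rintro x hx y (rfl | hy) hxy
      · exact Or.inr (Or.inr ⟨Or.inr (hNm x hx hxy.symm), Or.inl rfl⟩)
      · rcases hadj₁ y hy x hx hxy.symm with rfl | rfl
        exacts [Or.inr (Or.inl hbm), Or.inl (Or.inr hb₁)]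
    · rintro x (rfl | hx) y (rfl | hy) hxy
      · exact Or.inl (Or.inl rfl)
      · exact Or.inl (Or.inl rfl)
      · exact Or.inr (Or.inl (Or.inl rfl))
      · obtain ⟨rfl, rfl⟩ := hadj y hy x hx hxy.symm
        exact Or.inr (Or.inr ⟨Or.inr (Or.inr rfl), Or.inr (Or.inl rfl)⟩)
  · intro i; fin_cases i <;> assumption
  · intro i; fin_cases i <;> assumption
  · intro i x hx
    have := hR i x hx
    grind
  · intro i x hx y hy hxy
    rcases hR i x hx with rfl | hx
    · exact ⟨0, rfl, haN y hy hxy⟩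
    · rcases hTN x hx y hy hxy with h | h
      · exact ⟨1, h⟩
      · exact ⟨2, h⟩

/-- A hole, composed of a vertex `a` and an induced path `s`, together with a connected set `T` in
which exactly three vertices of the hole, `a` among them, have neighbours, and exactly one each. -/
theorem not_ISK4Free_of_hole (htri : G.CliqueFree 3) {a b c u v : V} {s : Set V}
    (hs : G.IsIndPath s u v) (has : a ∉ s)
    (hN : ∀ x ∈ s, G.Adj a x ↔ x = u ∨ x = v) (hb : b ∈ s) (hc : c ∈ s) (hbc : b ≠ c)
    {T : Set V} (hT : (G.induce T).Preconnected) {ta tb tc : V} (hta : ta ∈ T) (htb : tb ∈ T)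
    (htc : tc ∈ T) (haT : a ∉ T) (hsT : ∀ x ∈ s, x ∉ T)
    (hata : G.Adj a ta) (hbtb : G.Adj b tb) (hctc : G.Adj c tc)
    (haN : ∀ y ∈ T, G.Adj a y → y = ta)
    (hTN : ∀ x ∈ s, ∀ y ∈ T, G.Adj x y → x = b ∧ y = tb ∨ x = c ∧ y = tc) :
    ¬ G.ISK4Free := by
  obtain ⟨s₁, s₂, h₁, h₂, rfl, hd, hadj⟩ := hs.split hb
  have hu := (hN u (Or.inl h₁.left_mem)).2 (Or.inl rfl)
  have hv := (hN v (Or.inr h₂.right_mem)).2 (Or.inr rfl)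
  have hu₁ := h₁.left_mem
  have hv₂ := h₂.right_mem
  have hb₁ := h₁.right_mem
  have hb₂ := h₂.left_mem
  have aux : ∀ x ∈ s₁ ∪ s₂, x ∈ s₁ ∨ x ∈ s₂ := fun x hx => hx
  rcases hc with hc | hc
  -- Here `c` precedes `b`, so the hole is traversed in the opposite direction.
  · obtain ⟨m, s₀, hm, h₀, rfl, hd', hadj'⟩ := h₁.symm.split hc
    have hcm := hm.right_mem
    have hc0 := h₀.left_mem
    have hbm := hm.left_mem
    have hu0 := h₀.right_mem
    have hsym : ∀ x y, G.Adj x y → G.Adj y x := fun x y h => h.symm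
    refine not_ISK4Free_of_three_paths htri (s₁ := s₂) (m := m) (s₂ := s₀) (u := v) (v := u)
      h₂.symm hm h₀ hbc ?_ ?_ ?_ ?_ ?_ ?_ ?_ ?_ ?_ hv hu ?_ ?_ ?_ hT hta htb htc haT ?_ ?_ ?_
      hata hbtb hctc haN ?_ <;> simp only [Set.mem_union] at * <;> grind
  · obtain ⟨m, s₀, hm, h₀, rfl, hd', hadj'⟩ := h₂.split hc
    have hcm := hm.right_mem
    have hc0 := h₀.left_mem
    have hbm := hm.left_mem
    have hv0 := h₀.right_mem
    refine not_ISK4Free_of_three_paths htri (s₁ := s₁) (m := m) (s₂ := s₀) (u := u) (v := v)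
      h₁ hm h₀ hbc ?_ ?_ ?_ ?_ ?_ ?_ ?_ ?_ ?_ hu hv ?_ ?_ ?_ hT hta htb htc haT ?_ ?_ ?_
      hata hbtb hctc haN ?_ <;> simp only [Set.mem_union] at * <;> grind

/-! ### Layerings and connections through the upper layers. -/

/-- The function `lay` behaves like the distance from a vertex of a connected graph. -/
structure IsLayering (G : SimpleGraph V) (lay : V → ℕ) : Prop where
  le_add_one : ∀ {x y}, G.Adj x y → lay x ≤ lay y + 1
  exists_parent : ∀ {v}, lay v ≠ 0 → ∃ w, G.Adj v w ∧ lay w + 1 = lay v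
  root_unique : ∀ {x y}, lay x = 0 → lay y = 0 → x = y

theorem Connected.isLayering_dist (hG : G.Connected) (u : V) : G.IsLayering (G.dist u) where
  le_add_one {x y} h := by
    have := hG.dist_triangle (u := u) (v := y) (w := x)
    rwa [dist_eq_one_iff_adj.2 h.symm] at this
  exists_parent {v} hv := by
    obtain ⟨w, hw⟩ := hG.exists_walk_length_eq_dist v u
    cases w with
    | nil => simp at hv
    | @cons _ m _ h w =>
      refine ⟨m, h, ?_⟩
      have h1 := G.dist_le w
      have h2 := hG.dist_triangle (u := u) (v := m) (w := v)
      rw [dist_eq_one_iff_adj.2 h.symm] at h2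
      rw [dist_comm] at h1
      rw [dist_comm] at hw
      simp at hw
      omega
  root_unique hx hy := (hG.dist_eq_zero_iff.1 hx).symm.trans (hG.dist_eq_zero_iff.1 hy)

namespace IsLayering

variable {lay : V → ℕ}

/-- From every vertex one can descend within `S` to layer zero, which has only one vertex. -/
theorem preconnected (hL : G.IsLayering lay) {S : Set V}
    (hS : ∀ v ∈ S, lay v ≠ 0 → ∃ w ∈ S, G.Adj v w ∧ lay w < lay v) :
    (G.induce S).Preconnected := by
  have key : ∀ n, ∀ v : S, lay v = n → ∃ z : S, lay z = 0 ∧ (G.induce S).Reachable v z := by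
    intro n
    induction n using Nat.strong_induction_on with
    | _ n ih =>
      intro v hv
      by_cases h0 : lay v = 0
      · exact ⟨v, h0, Reachable.refl _⟩
      · obtain ⟨w, hw, hvw, hlt⟩ := hS v v.2 h0
        obtain ⟨z, hz, hr⟩ := ih _ (hv ▸ hlt) ⟨w, hw⟩ rfl
        exact ⟨z, hz, (Adj.reachable (show (G.induce S).Adj v ⟨w, hw⟩ from hvw)).trans hr⟩
  intro x y
  obtain ⟨z, hz, hxz⟩ := key _ x rfl
  obtain ⟨z', hz', hyz⟩ := key _ y rfl
  obtain rfl : z = z' := Subtype.ext (hL.root_unique hz hz')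
  exact hxz.trans hyz.symm

/-- Three vertices of a layer are joined through the layers above it. -/
theorem exists_confluence (hL : G.IsLayering lay) (htri : G.CliqueFree 3) {p q r : V} {j : ℕ}
    (hp : lay p = j) (hq : lay q = j) (hr : lay r = j) (hpq : p ≠ q) :
    (∃ T, (G.induce T).Preconnected ∧ q ∈ T ∧ r ∈ T ∧ (∀ x ∈ T, lay x < j ∨ x = q ∨ x = r) ∧
      ∃ t ∈ T, G.Adj p t ∧ ∀ y ∈ T, G.Adj p y → y = t) ∨
    ∃ s, G.IsIndPath s q r ∧ (∀ x ∈ s, lay x < j ∨ x = q ∨ x = r) ∧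
      ∃ t ∈ s, ∃ t' ∈ s, t ≠ t' ∧ ∀ y ∈ s, G.Adj p y ↔ y = t ∨ y = t' := by
  have hj : j ≠ 0 := by
    rintro rfl
    exact hpq (hL.root_unique hp hq)
  obtain ⟨p', hpp, hlp⟩ := hL.exists_parent (v := p) (by omega)
  obtain ⟨q', hqq, hlq⟩ := hL.exists_parent (v := q) (by omega)
  obtain ⟨r', hrr, hlr⟩ := hL.exists_parent (v := r) (by omega)
  -- Layer `j - 1` contributes only `q'` and `r'`, so that `p` has few possible neighbours in `T₁`.
  let T₁ : Set V := {x | lay x + 1 < j ∨ x = q' ∨ x = r' ∨ x = q ∨ x = r}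
  have hT₁ : (G.induce T₁).Preconnected := by
    refine hL.preconnected ?_
    rintro v (hv | rfl | rfl | rfl | rfl) h0
    · obtain ⟨w, hw, hlw⟩ := hL.exists_parent h0
      exact ⟨w, Or.inl (by omega), hw, by omega⟩
    · obtain ⟨w, hw, hlw⟩ := hL.exists_parent h0
      exact ⟨w, Or.inl (by omega), hw, by omega⟩
    · obtain ⟨w, hw, hlw⟩ := hL.exists_parent h0
      exact ⟨w, Or.inl (by omega), hw, by omega⟩
    · exact ⟨q', Or.inr (Or.inl rfl), hqq, by omega⟩
    · exact ⟨r', Or.inr (Or.inr (Or.inl rfl)), hrr, by omega⟩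
  have hlay : ∀ x ∈ T₁, lay x < j ∨ x = q ∨ x = r := by
    rintro x (h | rfl | rfl | rfl | rfl)
    · left; omega
    · left; omega
    · left; omega
    · simp
    · simp
  obtain ⟨s, hsT, hs⟩ := exists_isIndPath_subset hT₁ (u := q) (v := r) (by simp [T₁])
    (by simp [T₁])
  have hpN : ∀ x ∈ T₁, G.Adj p x → x = q' ∨ x = r' ∨ x = q ∨ x = r := by
    rintro x (h | h) hx
    · have := hL.le_add_one hx
      omega
    · exact h
  by_cases h1 : ∃ t ∈ s, G.Adj p t
  · obtain ⟨t, ht, hpt⟩ := h1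
    by_cases h2 : ∃ t' ∈ s, G.Adj p t' ∧ t ≠ t'
    · obtain ⟨t', ht', hpt', htt'⟩ := h2
      refine Or.inr ⟨s, hs, fun x hx => hlay x (hsT hx), t, ht, t', ht', htt', fun y hy =>
        ⟨fun hpy => ?_, ?_⟩⟩
      -- Without triangles, `p` has at most one neighbour in `{q, q'}` and one in `{r, r'}`, hence
      -- at most two on `s`.
      · have hnq : G.Adj p q → ¬ G.Adj p q' := fun h h' => not_adj_of_common_adj htri h h' hqq
        have hnr : G.Adj p r → ¬ G.Adj p r' := fun h h' => not_adj_of_common_adj htri h h' hrr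
        have a1 := hpN t (hsT ht) hpt
        have a2 := hpN t' (hsT ht') hpt'
        have a3 := hpN y (hsT hy) hpy
        clear hT₁ hlay hpN hs hsT
        grind
      · rintro (rfl | rfl) <;> assumption
    · push Not at h2
      exact Or.inl ⟨s, hs.connected.preconnected, hs.left_mem, hs.right_mem,
        fun x hx => hlay x (hsT hx), t, ht, hpt, fun y hy hpy => (h2 y hy hpy).symm⟩
  · push Not at h1
    left
    have hsing : ∀ x : V, (G.induce {x}).Preconnected := fun x =>
      (IsIndPath.single x).connected.preconnected
    -- As `p` has no neighbour on `s`, one is supplied: `q'` or `r'` if adjacent to `p`; otherwise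
    -- `p` sees nothing in `T₁`, and its parent `p'` is added.
    by_cases hq' : G.Adj p q'
    · refine ⟨s ∪ {q'}, (connected_induce_union hs.connected.preconnected (hsing q') hs.left_mem
        rfl hqq).preconnected, Or.inl hs.left_mem, Or.inl hs.right_mem, ?_, q', Or.inr rfl, hq', ?_⟩
      · rintro x (hx | rfl)
        exacts [hlay x (hsT hx), Or.inl (by omega)]
      · rintro y (hy | rfl) hpy
        exacts [absurd hpy (h1 y hy), rfl]
    by_cases hr' : G.Adj p r'
    · refine ⟨s ∪ {r'}, (connected_induce_union hs.connected.preconnected (hsing r') hs.right_mem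
        rfl hrr).preconnected, Or.inl hs.left_mem, Or.inl hs.right_mem, ?_, r', Or.inr rfl, hr', ?_⟩
      · rintro x (hx | rfl)
        exacts [hlay x (hsT hx), Or.inl (by omega)]
      · rintro y (hy | rfl) hpy
        exacts [absurd hpy (h1 y hy), rfl]
    · refine ⟨insert p' T₁, hL.preconnected ?_, Or.inr (hsT hs.left_mem),
        Or.inr (hsT hs.right_mem), ?_, p', Or.inl rfl, hpp, ?_⟩
      · rintro v (rfl | hv | rfl | rfl | rfl | rfl) h0
        · obtain ⟨w, hw, hlw⟩ := hL.exists_parent h0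
          exact ⟨w, Or.inr (Or.inl (by omega)), hw, by omega⟩
        · obtain ⟨w, hw, hlw⟩ := hL.exists_parent h0
          exact ⟨w, Or.inr (Or.inl (by omega)), hw, by omega⟩
        · obtain ⟨w, hw, hlw⟩ := hL.exists_parent h0
          exact ⟨w, Or.inr (Or.inl (by omega)), hw, by omega⟩
        · obtain ⟨w, hw, hlw⟩ := hL.exists_parent h0
          exact ⟨w, Or.inr (Or.inl (by omega)), hw, by omega⟩
        · exact ⟨q', Or.inr (Or.inr (Or.inl rfl)), hqq, by omega⟩
        · exact ⟨r', Or.inr (Or.inr (Or.inr (Or.inl rfl))), hrr, by omega⟩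
      · rintro x (rfl | hx)
        exacts [Or.inl (by omega), hlay x hx]
      · rintro y (rfl | hy) hpy
        · rfl
        · rcases hpN y hy hpy with rfl | rfl | rfl | rfl
          exacts [absurd hpy hq', absurd hpy hr', absurd hpy (h1 _ hs.left_mem),
            absurd hpy (h1 _ hs.right_mem)]

/-- A hole in two consecutive layers, with exactly one vertex `p` in the upper layer, and two
adjacent vertices `a` and `b` of the hole from which disjoint paths lead to further vertices `r` and
`q` of the upper layer. -/
theorem not_ISK4Free_of_legs (hL : G.IsLayering lay) (htri : G.CliqueFree 3) {p q r : V} {j : ℕ}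
    (hp : lay p = j) (hq : lay q = j) (hr : lay r = j) (hpq : p ≠ q)
    {A B D : Set V} {a a' b v d : V} (hA : G.IsIndPath A p a') (hB : G.IsIndPath B b v)
    (hD : G.IsIndPath D r d)
    (hlA : ∀ x ∈ A, x ≠ p → lay x = j + 1) (hla : lay a = j + 1) (hlB : ∀ x ∈ B, lay x = j + 1)
    (hlD : ∀ x ∈ D, x ≠ r → lay x = j + 1)
    (haA : a ∉ A) (haB : a ∉ B) (haD : a ∉ D) (hAB : ∀ x ∈ A, x ∉ B) (hAD : ∀ x ∈ A, x ∉ D)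
    (hBD : ∀ x ∈ B, x ∉ D) (hvb : v ≠ b)
    (haa' : G.Adj a a') (hab : G.Adj a b) (had : G.Adj a d) (hpv : G.Adj p v) (hbq : G.Adj b q)
    (haNA : ∀ x ∈ A, G.Adj a x → x = a') (haNB : ∀ x ∈ B, G.Adj a x → x = b)
    (haND : ∀ x ∈ D, G.Adj a x → x = d)
    (hNAB : ∀ x ∈ A, ∀ y ∈ B, G.Adj x y → x = p ∧ y = v)
    (hNAD : ∀ x ∈ A, ∀ y ∈ D, G.Adj x y → x = p ∧ y = r)
    (hNBD : ∀ x ∈ B, ∀ y ∈ D, ¬ G.Adj x y)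
    (hqa : ¬ G.Adj a q) (hqA : ∀ x ∈ A, G.Adj x q → x = p) (hqB : ∀ x ∈ B, G.Adj x q → x = b)
    (hqD : ∀ x ∈ D, G.Adj x q → x = r) : ¬ G.ISK4Free := by
  have hup : ∀ x y, lay x = j + 1 → lay y < j → ¬ G.Adj x y := fun x y hx hy h => by
    have := hL.le_add_one h
    omega
  have hpA := hA.left_mem
  have hbB := hB.left_mem
  have hrD := hD.left_mem
  have hlt : ∀ x, lay x = j + 1 → ∀ y, (lay y < j ∨ y = q ∨ y = r) → G.Adj x y → y = q ∨ y = r :=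
    fun x hx y hy hxy => hy.resolve_left fun h => hup x y hx h hxy
  rcases hL.exists_confluence htri hp hq hr hpq with
    ⟨T, hT, hqT, hrT, hlT, t, htT, hpt, htu⟩ | ⟨s, hs, hls, t, ht, t', ht', htt', hpN⟩
  -- The hole is `a`, `B`, `A`. The connected set `T ∪ D` sees it at `a`, `b` and `p`, through `d`,
  -- `q` and `t`.
  · have hBA : G.IsIndPath (B ∪ A) b a' := hB.join hA hpv.symm
      (fun x hx hx' => hAB x hx' hx) fun x hx y hy h => (hNAB y hy x hx h.symm).symm
    have hTD : (G.induce (T ∪ D)).Preconnected :=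
      (induce_union_connected hT hD.connected.preconnected ⟨r, hrT, hrD⟩).preconnected
    have hTlay : ∀ x ∈ T, lay x ≤ j := fun x hx => by
      rcases hlT x hx with h | rfl | rfl <;> omega
    refine not_ISK4Free_of_hole htri (a := a) (b := b) (c := p) hBA ?_ ?_ (Or.inl hbB) (Or.inr hpA)
      (fun h => hAB p hpA (h ▸ hbB)) hTD (ta := d) (tb := q) (tc := t) (Or.inr hD.right_mem)
      (Or.inl hqT) (Or.inl htT) ?_ ?_ had hbq hpt ?_ ?_
    · rintro (h | h)
      exacts [haB h, haA h]
    · rintro x hx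
      constructor
      · intro h
        rcases hx with hx | hx
        exacts [Or.inl (haNB x hx h), Or.inr (haNA x hx h)]
      · rintro (rfl | rfl) <;> assumption
    · rintro (h | h)
      · have := hTlay a h
        omega
      · exact haD h
    · rintro x (hx | hx) (h | h)
      · have := hTlay x h
        have := hlB x hx
        omega
      · exact hBD x hx h
      · by_cases hxp : x = p
        · subst hxp
          rcases hlT x h with h | rfl | rfl
          · omega
          · exact hpq rfl
          · exact hAD x hx hrD
        · have := hTlay x h
          have := hlA x hx hxp
          omega
      · exact hAD x hx h
    · rintro y (hy | hy) h
      · rcases hlt a hla y (hlT y hy) h with rfl | rfl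
        exacts [absurd h hqa, haND y hrD h]
      · exact haND y hy h
    · rintro x (hx | hx) y hy h
      · left
        rcases hy with hy | hy
        · rcases hlt x (hlB x hx) y (hlT y hy) h with rfl | rfl
          exacts [⟨hqB x hx h, rfl⟩, absurd h (hNBD x hx y hrD)]
        · exact absurd h (hNBD x hx y hy)
      · right
        rcases hy with hy | hy
        · by_cases hxp : x = p
          · subst hxp
            exact ⟨rfl, htu y hy h⟩
          · rcases hlt x (hlA x hx hxp) y (hlT y hy) h with rfl | rfl
            exacts [absurd (hqA x hx h) hxp, absurd (hNAD x hx y hrD h).1 hxp]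
        · obtain ⟨rfl, rfl⟩ := hNAD x hx y hy h
          exact ⟨rfl, htu y hrT h⟩
  · have hslay : ∀ x ∈ s, lay x ≤ j := fun x hx => by
      rcases hls x hx with h | rfl | rfl <;> omega
    -- Now the hole is `a`, `b`, `s`, `D`, and the connected set is `A`, which sees it at `a`, `t`
    -- and `t'`, the last two through `p`.
    have hsD : G.IsIndPath (s ∪ D) q d := by
      refine hs.append hD ?_ ?_
      · intro x hx hx'
        by_contra hxr
        have := hslay x hx
        have := hlD x hx' hxr
        omega
      · intro x hx y hy h
        by_contra! hne
        rcases hlt y (hlD y hy hne.2) x (hls x hx) h.symm with rfl | rfl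
        exacts [hne.2 (hqD y hy h.symm), hne.1 rfl]
    have hbs : b ∉ s := fun h => by
      have := hslay b h
      have := hlB b hbB
      omega
    have hbsD : G.IsIndPath (insert b (s ∪ D)) b d := by
      refine .cons hbq hsD ?_ ?_
      · rintro (h | h)
        exacts [hbs h, hBD b hbB h]
      · rintro x (hx | hx) h
        · rcases hlt b (hlB b hbB) x (hls x hx) h with rfl | rfl
          exacts [rfl, absurd h (hNBD b hbB x hrD)]
        · exact absurd h (hNBD b hbB x hx)
    refine not_ISK4Free_of_hole htri (a := a) (b := t) (c := t') hbsD ?_ ?_ (Or.inr (Or.inl ht))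
      (Or.inr (Or.inl ht')) htt' hA.connected.preconnected (ta := a') (tb := p) (tc := p)
      hA.right_mem hpA hpA haA ?_ haa' ((hpN t ht).2 (Or.inl rfl)).symm
      ((hpN t' ht').2 (Or.inr rfl)).symm haNA ?_
    · rintro (h | h | h)
      · exact haB (h ▸ hbB)
      · have := hslay a h
        omega
      · exact haD h
    · rintro x hx
      constructor
      · intro h
        rcases hx with rfl | hx | hx
        · exact Or.inl rfl
        · rcases hlt a hla x (hls x hx) h with rfl | rfl
          exacts [absurd h hqa, Or.inr (haND x hrD h)]
        · exact Or.inr (haND x hx h)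
      · rintro (rfl | rfl) <;> assumption
    · rintro x (rfl | hx | hx) hxA
      · exact hAB x hxA hbB
      · by_cases hxp : x = p
        · subst hxp
          rcases hls x hx with h | rfl | rfl
          · omega
          · exact hpq rfl
          · exact hAD x hxA hrD
        · have := hslay x hx
          have := hlA x hxA hxp
          omega
      · exact hAD x hxA hx
    · have hsp : ∀ x ∈ s, G.Adj x p → x = t ∧ p = p ∨ x = t' ∧ p = p := fun x hx h =>
        ((hpN x hx).1 h.symm).imp (⟨·, rfl⟩) (⟨·, rfl⟩)
      rintro x (rfl | hx | hx) y hy h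
      · obtain ⟨-, h'⟩ := hNAB y hy x hbB h.symm
        exact absurd h'.symm hvb
      · by_cases hyp : y = p
        · subst hyp
          exact hsp x hx h
        · rcases hlt y (hlA y hy hyp) x (hls x hx) h.symm with rfl | rfl
          exacts [absurd (hqA y hy h.symm) hyp, absurd (hNAD y hy x hrD h.symm).1 hyp]
      · obtain ⟨rfl, rfl⟩ := hNAD y hy x hx h.symm
        exact hsp x hs.right_mem h

end IsLayering

/-! ### Paths in a layer whose ends have a common neighbour above. -/

theorem isIndPath_of_sequence {c : ℕ → V} {m : ℕ} (hadj : ∀ i < m, G.Adj (c i) (c (i + 1)))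
    (hne : ∀ i k, i < k → k ≤ m → c i ≠ c k)
    (hchord : ∀ i k, i + 1 < k → k ≤ m → ¬ G.Adj (c i) (c k)) :
    G.IsIndPath {x | ∃ i ≤ m, c i = x} (c 0) (c m) := by
  induction m with
  | zero =>
    have : {x | ∃ i ≤ 0, c i = x} = {c 0} := by ext; simp [eq_comm]
    rw [this]
    exact .single _
  | succ m ih =>
    have hs : {x | ∃ i ≤ m + 1, c i = x} = insert (c (m + 1)) {x | ∃ i ≤ m, c i = x} := by
      ext x
      constructor
      · rintro ⟨i, hi, rfl⟩
        rcases hi.lt_or_eq with h | rfl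
        exacts [Or.inr ⟨i, by omega, rfl⟩, Or.inl rfl]
      · rintro (rfl | ⟨i, hi, rfl⟩)
        exacts [⟨m + 1, le_rfl, rfl⟩, ⟨i, by omega, rfl⟩]
    rw [hs]
    refine (IsIndPath.cons (hadj m (by omega)).symm (ih (fun i hi => hadj i (by omega))
      (fun i k h h' => hne i k h (by omega)) fun i k h h' => hchord i k h (by omega)).symm
      ?_ ?_).symm
    · rintro ⟨i, hi, h⟩
      exact hne i (m + 1) (by omega) le_rfl h
    · rintro _ ⟨i, hi, rfl⟩ h
      by_contra hne'
      exact hchord i (m + 1) (by by_contra h'; exact hne' (by congr 1; omega)) le_rfl h.symm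

namespace IsLayering

variable {lay : V → ℕ}

/-- The shortest case of `not_ISK4Free_of_legs`: the hole is the 4-cycle `p a b c`, and the legs at
`a` and `b` are single edges to `r` and `q`. -/
theorem not_ISK4Free_of_square (hL : G.IsLayering lay) (htri : G.CliqueFree 3) {p q r a b c : V}
    {j : ℕ} (hp : lay p = j) (hq : lay q = j) (hr : lay r = j) (hla : lay a = j + 1)
    (hlb : lay b = j + 1) (hlc : lay c = j + 1) (hac : a ≠ c) (hpa : G.Adj p a) (hpc : G.Adj p c)
    (hab : G.Adj a b) (hbc : G.Adj b c) (hbq : G.Adj b q) (har : G.Adj a r)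
    (hrc : ¬ G.Adj r c) : ¬ G.ISK4Free := by
  have hsym : ∀ x y, G.Adj x y → G.Adj y x := fun x y h => h.symm
  have hne : ∀ x y, lay x = j → lay y = j + 1 → x ≠ y := fun x y hx hy h => by subst h; omega
  have n1 : ¬ G.Adj a c := not_adj_of_common_adj htri hab.symm hbc
  have n2 : ¬ G.Adj p b := fun h => not_adj_of_common_adj htri hpa h hab
  have n3 : ¬ G.Adj q a := fun h => not_adj_of_common_adj htri hbq hab.symm h
  have n4 : ¬ G.Adj q c := fun h => not_adj_of_common_adj htri hbq hbc h
  have n5 : ¬ G.Adj r b := fun h => not_adj_of_common_adj htri hab har h.symm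
  have hpq : p ≠ q := by rintro rfl; exact n2 hbq.symm
  have hpr : p ≠ r := by rintro rfl; exact hrc hpc
  have irr : ∀ x, ¬ G.Adj x x := fun x => G.loopless.irrefl x
  have npr : ¬ G.Adj p r := not_adj_of_common_adj htri hpa.symm har
  have := hne p b hp hlb
  have := hne p c hp hlc
  have := hne p a hp hla
  have := hne r b hr hlb
  have := hne r c hr hlc
  have := hne r a hr hla
  have := hab.ne
  have := hbc.ne
  refine hL.not_ISK4Free_of_legs htri hp hq hr hpq (.single p) (.pair hbc) (.single r)
    (a := a) ?_ hla ?_ ?_ ?_ ?_ ?_ ?_ ?_ ?_ hbc.ne.symm hpa.symm hab har hpc hbq ?_ ?_ ?_ ?_ ?_ ?_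
    ?_ ?_ ?_ ?_ <;> grind

/-- The same 4-cycle, but `r` is reached from `a` through a further vertex `d` of the lower layer.
-/
theorem not_ISK4Free_of_square_of_edge (hL : G.IsLayering lay) (htri : G.CliqueFree 3)
    {p q r a b c d : V} {j : ℕ} (hp : lay p = j) (hq : lay q = j) (hr : lay r = j)
    (hla : lay a = j + 1) (hlb : lay b = j + 1) (hlc : lay c = j + 1) (hld : lay d = j + 1)
    (hac : a ≠ c) (hbd : b ≠ d) (hcd : c ≠ d) (hpa : G.Adj p a) (hpc : G.Adj p c) (hab : G.Adj a b)
    (hbc : G.Adj b c) (had : G.Adj a d) (hdc : ¬ G.Adj d c) (hbq : G.Adj b q) (hdr : G.Adj d r)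
    (hrb : ¬ G.Adj r b) (hrc : ¬ G.Adj r c) (hqd : ¬ G.Adj q d) : ¬ G.ISK4Free := by
  have hsym : ∀ x y, G.Adj x y → G.Adj y x := fun x y h => h.symm
  have hne : ∀ x y, lay x = j → lay y = j + 1 → x ≠ y := fun x y hx hy h => by subst h; omega
  have n1 : ¬ G.Adj a c := not_adj_of_common_adj htri hab.symm hbc
  have n2 : ¬ G.Adj p b := fun h => not_adj_of_common_adj htri hpa h hab
  have n3 : ¬ G.Adj q a := fun h => not_adj_of_common_adj htri hbq hab.symm h
  have n4 : ¬ G.Adj q c := fun h => not_adj_of_common_adj htri hbq hbc h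
  have n5 : ¬ G.Adj r a := fun h => not_adj_of_common_adj htri hdr had.symm h
  have n6 : ¬ G.Adj d b := not_adj_of_common_adj htri had hab
  have n7 : ¬ G.Adj p d := not_adj_of_common_adj htri hpa.symm had
  have hpq : p ≠ q := by rintro rfl; exact n2 hbq.symm
  have hpr : p ≠ r := by rintro rfl; exact hrc hpc
  have irr : ∀ x, ¬ G.Adj x x := fun x => G.loopless.irrefl x
  have := hne p b hp hlb
  have := hne p c hp hlc
  have := hne p a hp hla
  have := hne p d hp hld
  have := hne r b hr hlb
  have := hne r c hr hlc
  have := hne r a hr hla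
  have := hne r d hr hld
  have := hab.ne
  have := hbc.ne
  have := had.ne
  refine hL.not_ISK4Free_of_legs htri hp hq hr hpq (.single p) (.pair hbc) (.pair hdr.symm)
    (a := a) ?_ hla ?_ ?_ ?_ ?_ ?_ ?_ ?_ ?_ hbc.ne.symm hpa.symm hab had hpc hbq ?_ ?_ ?_ ?_ ?_ ?_
    ?_ ?_ ?_ ?_ <;> grind

/-- In no layer is there an induced path of length at least three whose ends, but no other of its
vertices, have a common neighbour in the layer above. -/
theorem not_ISK4Free_of_sequence (hL : G.IsLayering lay) (htri : G.CliqueFree 3) {j ℓ : ℕ}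
    (hℓ : 3 ≤ ℓ) {x : V} (hx : lay x = j) {c : ℕ → V} (hc : ∀ i ≤ ℓ, lay (c i) = j + 1)
    (hadj : ∀ i < ℓ, G.Adj (c i) (c (i + 1))) (hne : ∀ i k, i < k → k ≤ ℓ → c i ≠ c k)
    (hchord : ∀ i k, i + 1 < k → k ≤ ℓ → ¬ G.Adj (c i) (c k))
    (hxc : ∀ i ≤ ℓ, G.Adj x (c i) ↔ i = 0 ∨ i = ℓ) : ¬ G.ISK4Free := by
  intro hfree
  induction ℓ using Nat.strong_induction_on generalizing x c with
  | _ ℓ ih =>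
    have hpar : ∀ i ≤ ℓ, ∃ w, G.Adj w (c i) ∧ lay w = j := by
      intro i hi
      have h := hc i hi
      obtain ⟨w, hw, hlw⟩ := hL.exists_parent (v := c i) (by omega)
      exact ⟨w, hw.symm, by omega⟩
    have hcons : ∀ w i, i < ℓ → G.Adj w (c i) → ¬ G.Adj w (c (i + 1)) := fun w i hi h h' =>
      not_adj_of_common_adj htri h h' (hadj i hi)
    -- The next neighbour of a vertex of the layer above is at distance two along the path.
    have hnext : ∀ w i k, lay w = j → 0 < i → i < k → k ≤ ℓ → G.Adj w (c i) → G.Adj w (c k) →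
        i + 2 ≤ ℓ ∧ G.Adj w (c (i + 2)) := by
      intro w i k hw hi0 hik hk hwi hwk
      classical
      have hex : ∃ n, i < n ∧ n ≤ ℓ ∧ G.Adj w (c n) := ⟨k, hik, hk, hwk⟩
      obtain ⟨h1, h2, h3⟩ := Nat.find_spec hex
      have hmin := fun m => Nat.find_min hex (m := m)
      generalize Nat.find hex = n at *
      have hn1 : n ≠ i + 1 := by
        rintro rfl
        exact hcons w i (by omega) hwi h3
      by_cases hn : n = i + 2
      · subst hn
        exact ⟨h2, h3⟩
      exfalso
      refine ih (n - i) (by omega) (by omega) hw (c := fun m => c (m + i))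
        (fun m hm => hc _ (by omega))
        (fun m hm => by have := hadj (m + i) (by omega); rwa [Nat.add_right_comm] at this)
        (fun m l h h' => hne _ _ (by omega) (by omega))
        (fun m l h h' => hchord _ _ (by omega) (by omega)) fun m hm => ⟨fun h => ?_, ?_⟩
      · by_contra! hmn
        exact hmin (m + i) (by omega) ⟨by omega, by omega, h⟩
      · rintro (rfl | rfl)
        · simpa using hwi
        · simpa [Nat.sub_add_cancel h1.le] using h3
    have hx0 : G.Adj x (c 0) := (hxc 0 (by omega)).2 (Or.inl rfl)
    have hxn : ∀ i, 0 < i → i < ℓ → ¬ G.Adj x (c i) := fun i h h' hxi => by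
      have := (hxc i h'.le).1 hxi
      omega
    have hxl : G.Adj x (c ℓ) := (hxc ℓ le_rfl).2 (Or.inr rfl)
    have e01 := hadj 0 (by omega)
    have e12 := hadj 1 (by omega)
    have e23 := hadj 2 (by omega)
    -- No vertex above is adjacent to `c 0` and `c 2`.
    have hy0 : ∀ y, lay y = j → G.Adj y (c 2) → ¬ G.Adj y (c 0) := by
      intro y hy hy2 hy0
      obtain ⟨z, hz1, hz⟩ := hpar 1 (by omega)
      exact hL.not_ISK4Free_of_square htri hy hz hx (hc 0 (by omega)) (hc 1 (by omega))
        (hc 2 (by omega)) (hne 0 2 (by omega) (by omega)) hy0 hy2 e01 e12 hz1.symm hx0.symm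
        (hxn 2 (by omega) (by omega)) hfree
    obtain ⟨y, hy2, hy⟩ := hpar 2 (by omega)
    -- The neighbours of `c 1` above have no other neighbour on the path.
    have hz1 : ∀ z, lay z = j → G.Adj z (c 1) → ∀ k ≤ ℓ, G.Adj z (c k) → k = 1 := by
      intro z hz hz1 k hk hzk
      by_contra hk1
      rcases Nat.eq_zero_or_pos k with rfl | hk0
      · exact not_adj_of_common_adj htri hzk hz1 e01
      obtain ⟨-, hz3⟩ := hnext z 1 k hz (by omega) (by omega) hk hz1 hzk
      -- The 4-cycle is `z`, `c 1`, `c 2`, `c 3`. The third leg leads to `x`: directly from `c 3` if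
      -- that is the end of the path, otherwise from `c 1` through `c 0`, where `x` must not see `c
      -- 3`.
      rcases hℓ.eq_or_lt with rfl | hℓ'
      · exact hL.not_ISK4Free_of_square htri hz hy hx (hc 3 (by omega)) (hc 2 (by omega))
          (hc 1 (by omega)) (hne 1 3 (by omega) (by omega)).symm hz3 hz1 e23.symm e12.symm hy2.symm
          hxl.symm (hxn 1 (by omega) (by omega)) hfree
      · exact hL.not_ISK4Free_of_square_of_edge htri hz hy hx (hc 1 (by omega)) (hc 2 (by omega))
          (hc 3 (by omega)) (hc 0 (by omega)) (hne 1 3 (by omega) (by omega))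
          (hne 0 2 (by omega) (by omega)).symm (hne 0 3 (by omega) (by omega)).symm hz1 hz3 e12 e23
          e01.symm (hchord 0 3 (by omega) (by omega)) hy2.symm hx0.symm
          (hxn 2 (by omega) (by omega)) (hxn 3 (by omega) (by omega)) (hy0 y hy hy2) hfree
    obtain ⟨z, hz, hlz⟩ := hpar 1 (by omega)
    have hzN := hz1 z hlz hz
    by_cases hy' : ∃ k, 2 < k ∧ k ≤ ℓ ∧ G.Adj y (c k)
    · obtain ⟨k, hk2, hk, hyk⟩ := hy'
      -- The 4-cycle `y`, `c 2`, `c 3`, `c 4` has a leg from `c 2` through `c 1` to `z`, which sees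
      -- nothing else on the path.
      obtain ⟨hℓ4, hy4⟩ := hnext y 2 k hy (by omega) hk2 hk hy2 hyk
      obtain ⟨w, hw3, hw⟩ := hpar 3 (by omega)
      have e34 := hadj 3 (by omega)
      refine hL.not_ISK4Free_of_square_of_edge htri hy hw hlz (hc 2 (by omega)) (hc 3 (by omega))
          (hc 4 (by omega)) (hc 1 (by omega)) (hne 2 4 (by omega) (by omega))
          (hne 1 3 (by omega) (by omega)).symm (hne 1 4 (by omega) (by omega)).symm hy2 hy4 e23 e34
          e12.symm (hchord 1 4 (by omega) (by omega)) hw3.symm hz.symm (fun h => ?_) (fun h => ?_)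
          (fun h => ?_) hfree
      · have := hzN 3 (by omega) h
        omega
      · have := hzN 4 (by omega) h
        omega
      · have := hz1 w hw h 3 (by omega) hw3
        omega
    · have hyN : ∀ k ≤ ℓ, G.Adj y (c k) → k = 2 := by
        intro k hk hyk
        by_contra hk2
        have hk' : k = 0 ∨ k = 1 := by
          by_contra h
          exact hy' ⟨k, by omega, hk, hyk⟩
        rcases hk' with rfl | rfl
        · exact hy0 y hy hy2 hyk
        · exact not_adj_of_common_adj htri hyk hy2 e12
      have hlne : ∀ u i, lay u = j → i ≤ ℓ → u ≠ c i := by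
        rintro u i hu hi rfl
        have := hc i hi
        omega
      have hB := isIndPath_of_sequence (G := G) (c := fun m => c (m + 2)) (m := ℓ - 2)
        (fun m hm => by have := hadj (m + 2) (by omega); rwa [Nat.add_right_comm] at this)
        (fun m l h h' => hne _ _ (by omega) (by omega))
        (fun m l h h' => hchord _ _ (by omega) (by omega))
      have hxz : x ≠ z := by
        rintro rfl
        exact absurd (hzN 0 (by omega) hx0) (by omega)
      have hxy : x ≠ y := by
        rintro rfl
        exact absurd (hyN 0 (by omega) hx0) (by omega)
      have hl2 : ℓ - 2 + 2 = ℓ := by omega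
      have hz0 : ¬ G.Adj (c 0) z := fun h => absurd (hzN 0 (by omega) h.symm) (by omega)
      have hyc0 : ¬ G.Adj (c 0) y := fun h => absurd (hyN 0 (by omega) h.symm) (by omega)
      have hx1 := hxn 1 (by omega) (by omega)
      -- Now `y` and `z` each have a single neighbour on the path, `c 2` and `c 1`, so the whole
      -- hole through `x` can be used.
      refine hL.not_ISK4Free_of_legs htri hx hy hlz hxy (.pair hx0) hB (.single z) (a := c 1)
        ?_ (hc 1 (by omega)) ?_ ?_ ?_ ?_ (hlne z 1 hlz (by omega)).symm ?_ ?_ ?_ ?_ e01.symm e12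
        hz.symm (by simpa [hl2] using hxl) hy2.symm ?_ ?_ ?_ ?_ ?_ ?_ ?_ ?_ ?_ ?_ hfree
      · rintro u (rfl | rfl) h
        exacts [absurd rfl h, hc 0 (by omega)]
      · rintro _ ⟨i, hi, rfl⟩
        exact hc _ (by omega)
      · rintro u hu h
        exact absurd hu h
      · rintro (h | h)
        exacts [hlne x 1 hx (by omega) h.symm, hne 0 1 (by omega) (by omega) h.symm]
      · rintro ⟨i, hi, h⟩
        exact hne 1 (i + 2) (by omega) (by omega) h.symm
      · rintro u (rfl | rfl) ⟨i, hi, h⟩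
        exacts [hlne u _ hx (by omega) h.symm, hne 0 (i + 2) (by omega) (by omega) h.symm]
      · rintro u (rfl | rfl) h
        exacts [hxz h, hlne z 0 hlz (by omega) h.symm]
      · rintro _ ⟨i, hi, rfl⟩ h
        exact hlne z (i + 2) hlz (by omega) h.symm
      · exact (hne _ _ (by omega) (by omega)).symm
      · rintro u (rfl | rfl) h
        exacts [absurd h.symm hx1, rfl]
      · rintro _ ⟨i, hi, rfl⟩ h
        by_contra hi'
        refine hchord 1 (i + 2) ?_ (by omega) h
        rcases Nat.eq_zero_or_pos i with rfl | hi0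
        exacts [absurd rfl hi', by omega]
      · rintro u hu h
        exact hu
      · rintro u (rfl | rfl) _ ⟨i, hi, rfl⟩ h
        · have := (hxc (i + 2) (by omega)).1 h
          refine ⟨rfl, ?_⟩
          congr 1
          omega
        · exact absurd h (hchord 0 (i + 2) (by omega) (by omega))
      · rintro u (rfl | rfl) w rfl h
        exacts [⟨rfl, rfl⟩, absurd h hz0]
      · rintro _ ⟨i, hi, rfl⟩ w rfl h
        exact absurd (hzN (i + 2) (by omega) h.symm) (by omega)
      · exact fun h => absurd (hyN 1 (by omega) h.symm) (by omega)
      · rintro u (rfl | rfl) h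
        exacts [rfl, absurd h hyc0]
      · rintro _ ⟨i, hi, rfl⟩ h
        have := hyN (i + 2) (by omega) h.symm
        congr 1
      · exact fun u hu _ => hu

end IsLayering

/-! ### Odd cycles in a layer. -/

theorem exists_walk_of_sequence {c : ℕ → V} (hadj : ∀ i, G.Adj (c i) (c (i + 1))) (i d : ℕ) :
    ∃ w : G.Walk (c i) (c (i + d)), w.length = d := by
  induction d with
  | zero => exact ⟨.nil, rfl⟩
  | succ d ih =>
    obtain ⟨w, hw⟩ := ih
    exact ⟨w.concat (hadj (i + d)), by rw [Walk.length_concat, hw]⟩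

/-- A graph that is not bipartite contains an odd cycle without chords, given here as a periodic
sequence. -/
theorem exists_odd_sequence_of_not_colorable_two (h : ¬ G.Colorable 2) :
    ∃ (n : ℕ) (c : ℕ → V), Odd n ∧ (∀ i, c (i + n) = c i) ∧ (∀ i, G.Adj (c i) (c (i + 1))) ∧
      (∀ i d, 0 < d → d < n → c i ≠ c (i + d)) ∧
      ∀ i d, 2 ≤ d → d + 2 ≤ n → ¬ G.Adj (c i) (c (i + d)) := by
  classical
  rw [two_colorable_iff_forall_loop_even] at h
  push Not at h
  have hex : ∃ n, ∃ (u : V) (w : G.Walk u u), w.length = n ∧ Odd n := by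
    obtain ⟨u, w, hw⟩ := h
    exact ⟨_, u, w, rfl, Nat.not_even_iff_odd.1 hw⟩
  obtain ⟨u, w, hwn, hn⟩ := Nat.find_spec hex
  have hmin : ∀ m < Nat.find hex, ∀ (u : V) (w : G.Walk u u), w.length = m → ¬ Odd m :=
    fun m hm u w hw ho => Nat.find_min hex hm ⟨u, w, hw, ho⟩
  generalize Nat.find hex = n at *
  have hn0 : 0 < n := hn.pos
  have hper : ∀ i, w.getVert ((i + n) % n) = w.getVert (i % n) := fun i => by
    rw [Nat.add_mod_right]
  have hadj : ∀ i, G.Adj (w.getVert (i % n)) (w.getVert ((i + 1) % n)) := by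
    intro i
    have hi := Nat.mod_lt i hn0
    have := w.adj_getVert_succ (i := i % n) (by omega)
    rw [← Nat.mod_add_mod]
    rcases (show i % n + 1 ≤ n from hi).lt_or_eq with h1 | h1
    · rwa [Nat.mod_eq_of_lt h1]
    · rw [h1, Nat.mod_self, Walk.getVert_zero]
      have hlen : w.getVert n = u := hwn ▸ w.getVert_length
      rwa [h1, hlen] at this
  refine ⟨n, fun i => w.getVert (i % n), hn, hper, hadj, ?_, ?_⟩
  -- The sequence runs around a shortest odd closed walk. A repetition or a chord splits it into two
  -- shorter closed walks of total length `n` or `n + 2`, one of which is odd.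
  all_goals
    generalize hc : (fun i => w.getVert (i % n)) = c
    have hadj' : ∀ i, G.Adj (c i) (c (i + 1)) := by subst hc; exact hadj
    have hper' : ∀ i, c (i + n) = c i := by subst hc; exact hper
    intro i d h1 h2 h3
    obtain ⟨w₁, hw₁⟩ := exists_walk_of_sequence hadj' i d
    obtain ⟨w₂, hw₂⟩ := exists_walk_of_sequence hadj' (i + d) (n - d)
    have e : c (i + d + (n - d)) = c i := by
      rw [show i + d + (n - d) = i + n by omega, hper']
  · have a1 := hmin d h2 _ (w₁.copy rfl h3.symm) (by simpa using hw₁)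
    have a2 := hmin (n - d) (by omega) _ (w₂.copy h3.symm e) (by simpa using hw₂)
    rw [Nat.not_odd_iff_even] at a1 a2
    have := a1.add a2
    rw [show d + (n - d) = n by omega] at this
    exact Nat.not_odd_iff_even.2 this hn
  · have a1 := hmin (d + 1) (by omega) _ (w₁.concat h3.symm) (by simpa using hw₁)
    have a2 := hmin (n - d + 1) (by omega) _ ((w₂.copy rfl e).concat h3) (by simpa using hw₂)
    rw [Nat.not_odd_iff_even] at a1 a2
    have := a1.add a2
    rw [show d + 1 + (n - d + 1) = n + 2 by omega, Nat.even_add] at this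
    exact Nat.not_odd_iff_even.2 (this.2 even_two) hn

namespace IsLayering

variable {lay : V → ℕ}

/-- On a chordless odd cycle in a layer there is at most one
neighbour of each vertex of the layer above. -/
theorem not_adj_two (hL : G.IsLayering lay) (htri : G.CliqueFree 3) (hfree : G.ISK4Free)
    {n j : ℕ} {c : ℕ → V} (hn : Odd n) (hper : ∀ i, c (i + n) = c i)
    (hadj : ∀ i, G.Adj (c i) (c (i + 1))) (hne : ∀ i d, 0 < d → d < n → c i ≠ c (i + d))
    (hchord : ∀ i d, 2 ≤ d → d + 2 ≤ n → ¬ G.Adj (c i) (c (i + d)))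
    (hlay : ∀ i, lay (c i) = j + 1) {x : V} (hx : lay x = j) {i d : ℕ} (hd : 0 < d) (hdn : d < n)
    (hxi : G.Adj x (c i)) : ¬ G.Adj x (c (i + d)) := by
  intro hxd
  classical
  -- an interval of odd length between two neighbours of `x`
  obtain ⟨e, k, hek, hkn, hodd, he, hk, hbetween⟩ : ∃ e k, e < k ∧ k - e < n ∧ Odd (k - e) ∧
      G.Adj x (c e) ∧ G.Adj x (c k) ∧ ∀ m, e < m → m < k → ¬ G.Adj x (c m) := by
    -- The arc starts at the last neighbour of even offset `e` and ends at the next neighbour, whose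
    -- offset is odd or equal to `n`, which is odd as well.
    let P : ℕ → Prop := fun m => m < n ∧ Even m ∧ G.Adj x (c (i + m))
    have hP0 : P 0 := ⟨by omega, by simp, hxi⟩
    have hPe := Nat.findGreatest_spec (P := P) (Nat.zero_le n) hP0
    have hPmax := fun m => Nat.findGreatest_is_greatest (P := P) (n := n) (k := m)
    generalize Nat.findGreatest P n = e at *
    obtain ⟨hen, heven, hxe⟩ := hPe
    have hex : ∃ m, e < m ∧ G.Adj x (c (i + m)) := ⟨n, hen, by rwa [hper]⟩
    obtain ⟨hek, hxk⟩ := Nat.find_spec hex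
    have hmin := fun m => Nat.find_min hex (m := m)
    generalize Nat.find hex = k at *
    have hkn : k ≤ n := by
      by_contra! h
      exact hmin n h ⟨hen, by rwa [hper]⟩
    have hkodd : Odd k := by
      rcases hkn.lt_or_eq with h | rfl
      · by_contra hk
        exact hPmax k hek hkn ⟨h, Nat.not_odd_iff_even.1 hk, hxk⟩
      · exact hn
    refine ⟨i + e, i + k, by omega, ?_, ?_, hxe, hxk, ?_⟩
    -- Only the second neighbour `c (i + d)` prevents the arc from being the whole cycle.
    · by_contra! h
      obtain rfl : e = 0 := by omega
      obtain rfl : k = n := by omega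
      exact hmin d hdn ⟨hd, hxd⟩
    · rw [Nat.add_sub_add_left]
      exact Nat.Odd.sub_even hek.le hkodd heven
    · intro m h1 h2 h3
      refine hmin (m - i) (by omega) ⟨by omega, ?_⟩
      rwa [show i + (m - i) = m by omega]
  have hne1 : k - e ≠ 1 := by
    intro h
    obtain rfl : k = e + 1 := by omega
    exact not_adj_of_common_adj htri he hk (hadj e)
  -- Since `n` and `k - e` are odd, `k - e ≤ n - 2`, so the arc inherits the absence of chords.
  obtain ⟨a, ha⟩ := hodd
  obtain ⟨b, hb⟩ := hn
  refine hL.not_ISK4Free_of_sequence htri (ℓ := k - e) (by omega) hx (c := fun m => c (e + m))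
    (fun m hm => hlay _) (fun m hm => hadj _) (fun m l h h' => ?_) (fun m l h h' => ?_)
    (fun m hm => ⟨fun h => ?_, ?_⟩) hfree
  · have := hne (e + m) (l - m) (by omega) (by omega)
    rwa [show e + m + (l - m) = e + l by omega] at this
  · have := hchord (e + m) (l - m) (by omega) (by omega)
    rwa [show e + m + (l - m) = e + l by omega] at this
  · by_contra! h'
    exact hbetween (e + m) (by omega) (by omega) h
  · rintro (rfl | rfl)
    · exact he
    · rwa [show e + (k - e) = k by omega]

/-- By `not_adj_two` the parents of three consecutive vertices of an odd hole are distinct and see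
nothing else on it. The layers above connect them, which contradicts `not_ISK4Free_of_hole`. -/
theorem colorable_two_layer (hL : G.IsLayering lay) (htri : G.CliqueFree 3) (hfree : G.ISK4Free)
    (k : ℕ) : (G.induce {v | lay v = k}).Colorable 2 := by
  by_contra hcol
  obtain ⟨n, c', hn, hper', hadj', hne', hchord'⟩ := exists_odd_sequence_of_not_colorable_two hcol
  obtain ⟨c, hc⟩ : ∃ c : ℕ → V, ∀ i, (c' i).1 = c i := ⟨_, fun _ => rfl⟩
  have hlay : ∀ i, lay (c i) = k := fun i => hc i ▸ (c' i).2
  have hper : ∀ i, c (i + n) = c i := fun i => by rw [← hc, ← hc, hper']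
  have hadj : ∀ i, G.Adj (c i) (c (i + 1)) := fun i => by
    rw [← hc, ← hc]
    exact hadj' i
  have hne : ∀ i d, 0 < d → d < n → c i ≠ c (i + d) := fun i d h1 h2 h3 => by
    rw [← hc, ← hc] at h3
    exact hne' i d h1 h2 (Subtype.ext h3)
  have hchord : ∀ i d, 2 ≤ d → d + 2 ≤ n → ¬ G.Adj (c i) (c (i + d)) := fun i d h1 h2 h3 => by
    rw [← hc, ← hc] at h3
    exact hchord' i d h1 h2 h3
  clear hc hper' hadj' hne' hchord'
  obtain ⟨j, rfl⟩ : ∃ j, k = j + 1 := Nat.exists_eq_succ_of_ne_zero fun h0 =>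
    (hadj 0).ne (hL.root_unique ((hlay 0).trans h0) ((hlay 1).trans h0))
  have hn5 : 5 ≤ n := by
    have h1 : n ≠ 1 := by
      rintro rfl
      exact (hadj 0).ne (hper 0).symm
    have h3 : n ≠ 3 := by
      rintro rfl
      have := hadj 2
      rw [show 2 + 1 = 0 + 3 from rfl, hper] at this
      exact not_adj_of_common_adj htri (hadj 0) this.symm (hadj 1)
    obtain ⟨b, hb⟩ := hn
    omega
  have huniq : ∀ x, lay x = j → ∀ i d, 0 < d → d < n → G.Adj x (c i) → ¬ G.Adj x (c (i + d)) :=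
    fun x hx i d hd hdn => hL.not_adj_two htri hfree hn hper hadj hne hchord hlay hx hd hdn
  have hpar : ∀ i, ∃ w, G.Adj (c i) w ∧ lay w = j := fun i => by
    have h := hlay i
    obtain ⟨w, hw, hlw⟩ := hL.exists_parent (v := c i) (by omega)
    exact ⟨w, hw, by omega⟩
  obtain ⟨x, hx, hlx⟩ := hpar 0
  obtain ⟨y, hy, hly⟩ := hpar 1
  obtain ⟨z, hz, hlz⟩ := hpar 2
  let T : Set V := {v | lay v < j ∨ v = x ∨ v = y ∨ v = z}
  have hT : (G.induce T).Preconnected := by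
    refine hL.preconnected fun v hv h0 => ?_
    obtain ⟨w, hw, hlw⟩ := hL.exists_parent h0
    refine ⟨w, Or.inl ?_, hw, by omega⟩
    rcases hv with hv | rfl | rfl | rfl <;> omega
  have hcT : ∀ i, c i ∉ T := by
    intro i h
    have := hlay i
    rcases h with h | h | h | h
    · omega
    all_goals
      rw [h] at this
      omega
  have hTN : ∀ i, ∀ v ∈ T, G.Adj (c i) v → v = x ∨ v = y ∨ v = z := by
    rintro i v (hv | hv) h
    · have := hL.le_add_one h
      have := hlay i
      omega
    · exact hv
  have hs := isIndPath_of_sequence (G := G) (c := fun m => c (m + 1)) (m := n - 2)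
    (fun m hm => hadj _)
    (fun m l h h' => by
      have := hne (m + 1) (l - m) (by omega) (by omega)
      rwa [show m + 1 + (l - m) = l + 1 by omega] at this)
    (fun m l h h' => by
      have := hchord (m + 1) (l - m) (by omega) (by omega)
      rwa [show m + 1 + (l - m) = l + 1 by omega] at this)
  refine not_ISK4Free_of_hole htri (a := c 0) (b := c 1) (c := c 2) hs ?_ ?_ ⟨0, by omega, rfl⟩
    ⟨1, by omega, rfl⟩ (hadj 1).ne hT (ta := x) (tb := y) (tc := z) (by simp [T]) (by simp [T])
    (by simp [T]) (hcT 0) ?_ hx hy hz ?_ ?_ hfree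
  · rintro ⟨m, hm, h⟩
    have := hne 0 (m + 1) (by omega) (by omega)
    rw [Nat.zero_add] at this
    exact this h.symm
  · rintro _ ⟨m, hm, rfl⟩
    constructor
    · intro h
      have hm' : m = 0 ∨ m = n - 2 := by
        by_contra! hm'
        refine hchord 0 (m + 1) (by omega) (by omega) ?_
        rwa [Nat.zero_add]
      rcases hm' with rfl | rfl
      exacts [Or.inl rfl, Or.inr rfl]
    · rintro (h | h)
      · rw [h]
        exact hadj 0
      · have h1 := hadj (n - 2 + 1)
        rw [show n - 2 + 1 + 1 = 0 + n by omega, hper] at h1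
        rw [h]
        exact h1.symm
  · rintro _ ⟨m, hm, rfl⟩
    exact hcT _
  · intro v hv h
    rcases hTN 0 v hv h with rfl | rfl | rfl
    · rfl
    · exact absurd hy.symm (huniq v hly 0 1 (by omega) (by omega) h.symm)
    · exact absurd hz.symm (huniq v hlz 0 2 (by omega) (by omega) h.symm)
  · rintro _ ⟨m, hm, rfl⟩ v hv h
    rcases hTN _ v hv h with rfl | rfl | rfl
    · have := huniq v hlx 0 (m + 1) (by omega) (by omega) hx.symm
      rw [Nat.zero_add] at this
      exact absurd h.symm this
    · rcases Nat.eq_zero_or_pos m with rfl | hm0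
      · exact Or.inl ⟨rfl, rfl⟩
      · have := huniq v hly 1 m hm0 (by omega) hy.symm
        rw [Nat.add_comm] at this
        exact absurd h.symm this
    · rcases Nat.eq_zero_or_pos m with rfl | hm0
      · exact absurd hz.symm (huniq v hlz 1 1 (by omega) (by omega) h.symm)
      · by_cases hm1 : m = 1
        · subst hm1
          exact Or.inr ⟨rfl, rfl⟩
        · have := huniq v hlz 2 (m - 1) (by omega) (by omega) hz.symm
          rw [show 2 + (m - 1) = m + 1 by omega] at this
          exact absurd h.symm this

/-! ### The colouring, and reduction to components. -/

theorem colorable_four (hL : G.IsLayering lay) (htri : G.CliqueFree 3) (hfree : G.ISK4Free) :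
    G.Colorable 4 := by
  have hcol := fun k => (hL.colorable_two_layer htri hfree k).some
  let C : G.Coloring (Fin 2 × Fin 2) := Coloring.mk
    (fun v => (⟨lay v % 2, Nat.mod_lt _ two_pos⟩, hcol (lay v) ⟨v, rfl⟩)) (by
      intro u v huv h
      rw [Prod.mk.injEq, Fin.mk.injEq] at h
      have h1 := hL.le_add_one huv
      have h2 := hL.le_add_one huv.symm
      -- The layers of adjacent vertices differ by at most one, so equal parity means the same
      -- layer.
      have h3 : lay u = lay v := by omega
      have h4 : ∀ w k (hw : lay w = k), hcol (lay w) ⟨w, rfl⟩ = hcol k ⟨w, hw⟩ := by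
        rintro w _ rfl
        rfl
      refine (hcol (lay v)).valid (v := ⟨u, h3⟩) (w := ⟨v, rfl⟩) huv ?_
      rw [← h4]
      exact h.2)
  simpa using C.colorable

end IsLayering

/-- Needed to regard an induced subgraph of a component as an induced subgraph of the whole graph.
-/
theorem IsSubdivision.congr {α β γ : Type*} {H : SimpleGraph α} {K : SimpleGraph β}
    {K' : SimpleGraph γ} (h : IsSubdivision H K) (e : K ≃g K') : IsSubdivision H K' := by
  obtain ⟨D⟩ := h
  have hinj : Function.Injective e.toHom := e.injective
  refine ⟨⟨fun a => e (D.branch a), e.injective.comp D.branch_injective,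
    fun {u v} h => (D.path h).map e.toHom, fun h => (D.path_isPath h).map hinj, ?_, ?_, ?_, ?_, ?_⟩⟩
  · intro u v h
    rw [D.path_symm h, Walk.reverse_map]
  · intro u v h x hx
    rw [Walk.support_map, List.mem_map] at hx
    obtain ⟨y, hy, hyx⟩ := hx
    obtain rfl := hinj hyx
    exact D.branch_mem_path h x hy
  · intro u v u' v' h h' hne w hw hw'
    rw [Walk.support_map, List.mem_map] at hw hw'
    obtain ⟨y, hy, rfl⟩ := hw
    obtain ⟨y', hy', hyy⟩ := hw'
    obtain rfl := hinj hyy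
    obtain ⟨a, rfl⟩ := D.path_disjoint h h' hne y' hy hy'
    exact ⟨a, rfl⟩
  · intro w
    rcases D.vertex_cover (e.symm w) with ⟨a, ha⟩ | ⟨u, v, h, hw⟩
    · exact Or.inl ⟨a, by simp [ha]⟩
    · refine Or.inr ⟨u, v, h, ?_⟩
      rw [Walk.support_map, List.mem_map]
      exact ⟨_, hw, e.apply_symm_apply w⟩
  · intro s hs
    induction s using Sym2.ind with
    | _ x y =>
      obtain ⟨u, v, h, hw⟩ := D.edge_cover s(e.symm x, e.symm y) (e.symm.map_adj_iff.2 hs)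
      refine ⟨u, v, h, ?_⟩
      rw [Walk.edges_map, List.mem_map]
      refine ⟨_, hw, ?_⟩
      rw [Sym2.map_mk]
      exact congrArg₂ (fun a b => s(a, b)) (e.apply_symm_apply x) (e.apply_symm_apply y)

theorem ISK4Free.induce (h : G.ISK4Free) (s : Set V) : (G.induce s).ISK4Free := fun S hS =>
  h (Subtype.val '' S) (hS.congr
    { toEquiv := Equiv.Set.image Subtype.val S Subtype.val_injective
      map_rel_iff' := Iff.rfl })

end SimpleGraph

theorem theorem1 {V : Type*} [Finite V] (G : SimpleGraph V)
    (hISK4 : G.ISK4Free) (htriangle : G.CliqueFree 3) :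
    G.chromaticNumber ≤ 4 := by
  refine SimpleGraph.Colorable.chromaticNumber_le (n := 4) ?_
  refine SimpleGraph.colorable_iff_forall_connectedComponent.2 fun C => ?_
  obtain ⟨u, hu⟩ := C.nonempty_supp
  exact (C.connected_toSimpleGraph.isLayering_dist ⟨u, hu⟩).colorable_four
    (htriangle.comap ⟨SimpleGraph.Copy.induce G C.supp⟩) (hISK4.induce C.supp)
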